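/- Let $N\ge 0$, $x_1<\dots<x_N$ real, $m_j>0$, $n_j>0$ ($1\le j\le N$), $\mathbf m_j=(m_j,n_j)^T$, and let $\langle \mathbf u,\mathbf w\rangle=u_1w_2+u_2w_1=\mathbf u^*\mathbf w$ with $\mathbf u^*=[u_2,u_1]$. Define polynomials $A,C\in\mathbb R[\lambda]$ and $\mathbf B\in\mathbb R[\lambda]^2$ by $$\begin{bmatrix}A(\lambda)\\ \mathbf B(\lambda)\\ C(\lambda)\end{bmatrix}=S_N(\lambda)\cdots S_1(\lambda)\begin{bmatrix}1\\0_{2\times 1}\\0\end{bmatrix},\qquad S_k(\lambda)=\begin{bmatrix}1-\lambda\langle\mathbf m_k,\mathbf m_k\rangle&-2\lambda\mathbf m_k^*e^{-x_k}&-\lambda^2\langle\mathbf m_k,\mathbf m_k\rangle e^{-2x_k}\\ \mathbf m_ke^{x_k}&1_{2}&\lambda\mathbf m_ke^{-x_k}\\ \langle\mathbf m_k,\mathbf m_k\rangle e^{2x_k}&2\mathbf m_k^*e^{x_k}&1+\lambda\langle\mathbf m_k,\mathbf m_k\rangle\end{bmatrix}.$$ These are the coefficients of the Lax system $\phi_1'=z\langle\mathbf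 m,\phi_2\rangle+\phi_3$, $\phi_2'=z\,\mathbf m\,\phi_3$, $\phi_3'=\phi_1$ with $\mathbf m=2\sum_j\mathbf m_j\delta_{x_j}$ and $\lambda=-z^2$ (where $\phi_2$ is assigned at $x_j$ the average of its one-sided limits): the solution equal to $(e^x,0,e^x)$ for $x<x_1$ equals $(Ae^x-\lambda Ce^{-x},\,2z\mathbf B,\,Ae^x+\lambda Ce^{-x})$ for $x>x_N$. Define the Weyl functions $$\mathbf W(\lambda)=-\frac{\mathbf B(\lambda)}{A(\lambda)},\qquad Z(\lambda)=-\frac{C(\lambda)}{2A(\lambda)} .$$ Call $z\in\mathbb C$ an eigenvalue if the Lax system has a nontrivial solution with $\phi_3(-\infty)=0$, $\phi_2(-\infty)=0$, $\phi_3(+\infty)=0$. Then there are real numbers $\lambda_1>\lambda_2>\dots>\lambda_N>0$ such that $z$ is an eigenvalue if and only if $-z^2\in\{\lambda_1,\dots,\lambda_N\}$, and $A(\lambda)=\prod_{k=1}^N(1-\lambda/\lambda_k)$. At every $\lambda_k$ the functions $\mathbf W$ and $Z$ have a simple pole, with residues $$\mathbf b_k=\operatorname{Res}\{\mathbf W;\lambda_k\}>0\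 \text{(both components)},\qquad c_k=\operatorname{Res}\{Z;\lambda_k\}>0,\qquad c_k=\sum_{p=1}^N\frac{\langle\mathbf b_k,\mathbf b_p\rangle}{\lambda_k+\lambda_p},$$ and, with the positive discrete vector measure $\boldsymbol\mu=\sum_{j=1}^N\mathbf b_j\delta_{\lambda_j}$, for all $\lambda\in\mathbb C\setminus\{\lambda_1,\dots,\lambda_N\}$ $$\mathbf W(\lambda)=\sum_{k=1}^N\frac{\mathbf b_k}{\lambda-\lambda_k}=\int\frac{d\boldsymbol\mu(s)}{\lambda-s},\qquad Z(\lambda)=\sum_{k=1}^N\frac{c_k}{\lambda-\lambda_k}=\iint\frac{\langle d\boldsymbol\mu(s),d\boldsymbol\mu(t)\rangle}{(\lambda-s)(s+t)} .$$ -/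

import Mathlib

open Filter Topology MeasureTheory Polynomial

noncomputable section

namespace NovikovPeakon

/-- The symmetric bilinear form `⟨u, w⟩ = u₁ w₂ + u₂ w₁` on two-component vectors. -/
def pairing {R : Type*} [CommRing R] (u w : Fin 2 → R) : R := u 0 * w 1 + u 1 * w 0

/-- The transition matrix `S(λ)` through a site at position `x` with the mass vector `(m, n)`.
Its entries are real polynomials in the spectral variable `λ = X`; the blocks have sizes 1, 2, 1. -/
def stepMatrix (x m n : ℝ) : Matrix (Fin 4) (Fin 4) ℝ[X] :=
  let q : ℝ := pairing ![m, n] ![m, n]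
  !![1 - C q * X, -(C (2 * n * Real.exp (-x)) * X), -(C (2 * m * Real.exp (-x)) * X),
      -(C (q * Real.exp (-2 * x)) * X ^ 2);
    C (m * Real.exp x), 1, 0, C (m * Real.exp (-x)) * X;
    C (n * Real.exp x), 0, 1, C (n * Real.exp (-x)) * X;
    C (q * Real.exp (2 * x)), C (2 * n * Real.exp x), C (2 * m * Real.exp x), 1 + C q * X]

/-- The vector `(A_k, B_k, C_k)`, that is `S_k(λ) ⋯ S_1(λ) (1, 0, 0, 0)ᵀ`, for `k ≤ N`
(the site called `k + 1` in the usual numbering has the index `k : Fin N`). -/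
def coeffVec {N : ℕ} (x m n : Fin N → ℝ) : ℕ → Fin 4 → ℝ[X]
  | 0 => ![1, 0, 0, 0]
  | k + 1 =>
    if h : k < N then
      Matrix.mulVec (stepMatrix (x ⟨k, h⟩) (m ⟨k, h⟩) (n ⟨k, h⟩)) (coeffVec x m n k)
    else coeffVec x m n k

/-- The polynomial `A(λ)`. -/
def polyA {N : ℕ} (x m n : Fin N → ℝ) : ℝ[X] := coeffVec x m n N 0

/-- The components of the vector polynomial `B(λ)`. -/
def polyB {N : ℕ} (x m n : Fin N → ℝ) : Fin 2 → ℝ[X] :=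
  ![coeffVec x m n N 1, coeffVec x m n N 2]

/-- The polynomial `C(λ)`. -/
def polyC {N : ℕ} (x m n : Fin N → ℝ) : ℝ[X] := coeffVec x m n N 3

/-- The vector Weyl function `W = -B / A`. -/
def weylW {N : ℕ} (x m n : Fin N → ℝ) (w : ℂ) (a : Fin 2) : ℂ :=
  -(aeval w (polyB x m n a) / aeval w (polyA x m n))

/-- The scalar Weyl function `Z = -C / (2 A)`. -/
def weylZ {N : ℕ} (x m n : Fin N → ℝ) (w : ℂ) : ℂ :=
  -(aeval w (polyC x m n) / (2 * aeval w (polyA x m n)))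

/-- `(φ₁, φ₂, φ₃)` solves the Lax system
`φ₁' = z ⟨𝐦, φ₂⟩ + φ₃`, `φ₂' = z 𝐦 φ₃`, `φ₃' = φ₁` with `𝐦 = 2 ∑ (m_k, n_k) δ_{x_k}`
in the sense of distributions, where the value of `φ₂` at `x_k` is the mean of its one-sided limits. -/
structure IsLaxSolution {N : ℕ} (x m n : Fin N → ℝ) (z : ℂ)
    (φ₁ : ℝ → ℂ) (φ₂ : ℝ → Fin 2 → ℂ) (φ₃ : ℝ → ℂ) : Prop where
  continuous : Continuous φ₃
  deriv_one : ∀ y, y ∉ Set.range x → HasDerivAt φ₁ (φ₃ y) y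
  deriv_two : ∀ y, y ∉ Set.range x → HasDerivAt φ₂ 0 y
  deriv_three : ∀ y, y ∉ Set.range x → HasDerivAt φ₃ (φ₁ y) y
  jump : ∀ k, ∃ (l r : Fin 2 → ℂ) (l₁ r₁ : ℂ),
    Tendsto φ₂ (𝓝[<] x k) (𝓝 l) ∧ Tendsto φ₂ (𝓝[>] x k) (𝓝 r) ∧
    Tendsto φ₁ (𝓝[<] x k) (𝓝 l₁) ∧ Tendsto φ₁ (𝓝[>] x k) (𝓝 r₁) ∧
    r - l = (2 * z * φ₃ (x k)) • ![(m k : ℂ), (n k : ℂ)] ∧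
    r₁ - l₁ = 2 * z * pairing ![(m k : ℂ), (n k : ℂ)] ((1 / 2 : ℂ) • (l + r))

/-- `z` is an eigenvalue of the boundary value problem: the Lax system has a nontrivial solution
with `φ₃(-∞) = 0`, `φ₂(-∞) = 0` and `φ₃(+∞) = 0`. (The values of `φ₁`, `φ₂` at the sites are
immaterial, so nontriviality is tested off the sites.) -/
def IsLaxEigenvalue {N : ℕ} (x m n : Fin N → ℝ) (z : ℂ) : Prop :=
  ∃ (φ₁ : ℝ → ℂ) (φ₂ : ℝ → Fin 2 → ℂ) (φ₃ : ℝ → ℂ), IsLaxSolution x m n z φ₁ φ₂ φ₃ ∧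
    (∃ y, y ∉ Set.range x ∧ (φ₁ y ≠ 0 ∨ φ₂ y ≠ 0 ∨ φ₃ y ≠ 0)) ∧
    Tendsto φ₃ atBot (𝓝 0) ∧ Tendsto φ₂ atBot (𝓝 0) ∧ Tendsto φ₃ atTop (𝓝 0)

/-- `f` has at `a` at most a simple pole, and its residue there is `c`. -/
def HasSimpleResidue (f : ℂ → ℂ) (a c : ℂ) : Prop :=
  ∃ g : ℂ → ℂ, AnalyticAt ℂ g a ∧ ∀ᶠ w in 𝓝[≠] a, f w = c / (w - a) + g w

/-- The component `a` of the discrete vector measure `∑ₖ bₖ δ_{λₖ}`. -/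
def spectralMeasure {N : ℕ} (lam : Fin N → ℝ) (b : Fin N → Fin 2 → ℝ) (a : Fin 2) : Measure ℝ :=
  ∑ k, ENNReal.ofReal (b k a) • Measure.dirac (lam k)

/-- The double integral `∬ f(s, t) ⟨dμ(s), dμ(t)⟩` against a vector measure `μ = (μ₁, μ₂)`. -/
def pairingIntegral (μ : Fin 2 → Measure ℝ) (f : ℝ → ℝ → ℂ) : ℂ :=
  (∫ s, ∫ t, f s t ∂(μ 1) ∂(μ 0)) + ∫ s, ∫ t, f s t ∂(μ 0) ∂(μ 1)

/-! The relation between the transition matrices and the Lax system. -/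

/-- The interval between the site number `k` and the next one. -/
def region {N : ℕ} (x : Fin N → ℝ) (k : ℕ) : Set ℝ :=
  {y | ∀ j : Fin N, (j.val < k → x j < y) ∧ (k ≤ j.val → y < x j)}

/-- The coefficient polynomials of the region number `k`, evaluated at `-z ^ 2`. -/
def coeffVal {N : ℕ} (x m n : Fin N → ℝ) (z : ℂ) (k : ℕ) (i : Fin 4) : ℂ :=
  aeval (-z ^ 2) (coeffVec x m n k i)

lemma coeffVal_zero {N : ℕ} (x m n : Fin N → ℝ) (z : ℂ) :
    coeffVal x m n z 0 = ![1, 0, 0, 0] := by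
  funext i; fin_cases i <;> simp [coeffVal, coeffVec]

lemma coeffVal_succ {N : ℕ} (x m n : Fin N → ℝ) (z : ℂ) (k : Fin N) (E : ℂ)
    (hE : E = Complex.exp (x k)) :
    coeffVal x m n z (k.val + 1) 0 = (1 + z ^ 2 * (2 * m k * n k)) * coeffVal x m n z k 0
        + 2 * z ^ 2 * n k * E⁻¹ * coeffVal x m n z k 1
        + 2 * z ^ 2 * m k * E⁻¹ * coeffVal x m n z k 2
        - z ^ 4 * (2 * m k * n k) * (E⁻¹) ^ 2 * coeffVal x m n z k 3 ∧
    coeffVal x m n z (k.val + 1) 1 = m k * E * coeffVal x m n z k 0 + coeffVal x m n z k 1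
        - z ^ 2 * m k * E⁻¹ * coeffVal x m n z k 3 ∧
    coeffVal x m n z (k.val + 1) 2 = n k * E * coeffVal x m n z k 0 + coeffVal x m n z k 2
        - z ^ 2 * n k * E⁻¹ * coeffVal x m n z k 3 ∧
    coeffVal x m n z (k.val + 1) 3 = 2 * m k * n k * E ^ 2 * coeffVal x m n z k 0
        + 2 * n k * E * coeffVal x m n z k 1 + 2 * m k * E * coeffVal x m n z k 2
        + (1 - z ^ 2 * (2 * m k * n k)) * coeffVal x m n z k 3 := by
  have h1 : Complex.exp (-(x k : ℂ)) = E⁻¹ := by rw [hE, Complex.exp_neg]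
  have h2 : Complex.exp (2 * (x k : ℂ)) = E ^ 2 := by
    rw [hE, ← Complex.exp_nat_mul]; norm_num
  have h3 : Complex.exp (-(2 * (x k : ℂ))) = (E⁻¹) ^ 2 := by
    rw [Complex.exp_neg, h2, inv_pow]
  refine ⟨?_, ?_, ?_, ?_⟩ <;>
  · simp [coeffVal, coeffVec, stepMatrix, Matrix.mulVec, dotProduct, Fin.sum_univ_four,
      pairing, h1, h2, h3, ← hE]
    ring

lemma isOpen_region {N : ℕ} (x : Fin N → ℝ) (k : ℕ) : IsOpen (region x k) := by
  have : region x k = ⋂ j : Fin N, {y | (j.val < k → x j < y) ∧ (k ≤ j.val → y < x j)} := by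
    ext y; simp [region]
  rw [this]
  refine isOpen_iInter_of_finite fun j => ?_
  rcases lt_or_ge j.val k with h | h
  · simpa [h, not_le.mpr h] using isOpen_lt continuous_const continuous_id
  · simpa [h, not_lt.mpr h] using isOpen_lt continuous_id continuous_const

lemma isPreconnected_region {N : ℕ} (x : Fin N → ℝ) (k : ℕ) : IsPreconnected (region x k) := by
  have : (region x k).OrdConnected := by
    refine ⟨fun y hy w hw t ht j => ⟨fun h => ?_, fun h => ?_⟩⟩
    · exact ((hy j).1 h).trans_le ht.1
    · exact ht.2.trans_lt ((hw j).2 h)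
  exact this.isPreconnected

lemma notMem_range_of_region {N : ℕ} {x : Fin N → ℝ} {k : ℕ} {y : ℝ} (hy : y ∈ region x k) :
    y ∉ Set.range x := by
  rintro ⟨j, rfl⟩
  rcases lt_or_ge j.val k with h | h
  · exact lt_irrefl _ ((hy j).1 h)
  · exact lt_irrefl _ ((hy j).2 h)

lemma region_left {N : ℕ} {x : Fin N → ℝ} (hx : StrictMono x) (k : Fin N) :
    ∀ᶠ y in 𝓝[<] x k, y ∈ region x k := by
  refine eventually_all.2 fun j => ?_
  rcases lt_or_ge j.val k.val with h | h
  · filter_upwards [eventually_nhdsWithin_of_eventually_nhds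
      (eventually_gt_nhds (hx (show j < k from h)))] with y hy
    exact ⟨fun _ => hy, fun h' => absurd h (not_lt.mpr h')⟩
  · filter_upwards [self_mem_nhdsWithin] with y hy
    exact ⟨fun h' => absurd h' (not_lt.mpr h),
      fun _ => lt_of_lt_of_le hy (hx.monotone (show k ≤ j from h))⟩

lemma region_right {N : ℕ} {x : Fin N → ℝ} (hx : StrictMono x) (k : Fin N) :
    ∀ᶠ y in 𝓝[>] x k, y ∈ region x (k.val + 1) := by
  refine eventually_all.2 fun j => ?_
  rcases lt_or_ge j.val (k.val + 1) with h | h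
  · filter_upwards [self_mem_nhdsWithin] with y hy
    exact ⟨fun _ => lt_of_le_of_lt (hx.monotone (show j ≤ k from Nat.lt_succ_iff.mp h)) hy,
      fun h' => absurd h (not_lt.mpr h')⟩
  · filter_upwards [eventually_nhdsWithin_of_eventually_nhds
      (eventually_lt_nhds (hx (show k < j from h)))] with y hy
    exact ⟨fun h' => absurd h' (not_lt.mpr h), fun _ => hy⟩

/-- The number of sites to the left of `y`. -/
def siteCount {N : ℕ} (x : Fin N → ℝ) (y : ℝ) : ℕ :=
  (Finset.univ.filter fun j => x j < y).card

lemma lt_siteCount_iff {N : ℕ} {x : Fin N → ℝ} (hx : StrictMono x) (y : ℝ) (j : Fin N) :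
    j.val < siteCount x y ↔ x j < y := by
  constructor
  · intro h
    by_contra hc
    have hsub : (Finset.univ.filter fun i => x i < y) ⊆ Finset.Iio j := by
      intro i hi
      rw [Finset.mem_filter] at hi
      rw [Finset.mem_Iio]
      by_contra hij
      exact hc (lt_of_le_of_lt (hx.monotone (not_lt.mp hij)) hi.2)
    have := Finset.card_le_card hsub
    rw [Fin.card_Iio] at this
    exact absurd h (not_lt.mpr this)
  · intro h
    have hsub : Finset.Iic j ⊆ (Finset.univ.filter fun i => x i < y) := by
      intro i hi
      rw [Finset.mem_Iic] at hi
      rw [Finset.mem_filter]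
      exact ⟨Finset.mem_univ _, lt_of_le_of_lt (hx.monotone hi) h⟩
    have := Finset.card_le_card hsub
    rw [Fin.card_Iic] at this
    exact this

lemma siteCount_le {N : ℕ} (x : Fin N → ℝ) (y : ℝ) : siteCount x y ≤ N := by
  have := Finset.card_filter_le (Finset.univ : Finset (Fin N)) (fun j => x j < y)
  rwa [Finset.card_fin] at this

lemma siteCount_eq {N : ℕ} {x : Fin N → ℝ} (hx : StrictMono x) {k : ℕ} (hk : k ≤ N) {y : ℝ}
    (hy : y ∈ region x k) : siteCount x y = k := by
  have hle := siteCount_le x y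
  rcases lt_trichotomy (siteCount x y) k with h | h | h
  · have hj := (hy ⟨siteCount x y, by omega⟩).1 h
    exact absurd ((lt_siteCount_iff hx y _).2 hj) (lt_irrefl _)
  · exact h
  · have hj := (lt_siteCount_iff hx y ⟨k, by omega⟩).1 h
    exact absurd hj (not_lt.mpr ((hy ⟨k, by omega⟩).2 le_rfl).le)

lemma mem_region_siteCount {N : ℕ} {x : Fin N → ℝ} (hx : StrictMono x) {y : ℝ}
    (hy : y ∉ Set.range x) : y ∈ region x (siteCount x y) := by
  intro j
  refine ⟨(lt_siteCount_iff hx y j).1, fun h => ?_⟩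
  have h1 : ¬ x j < y := fun hc => absurd ((lt_siteCount_iff hx y j).2 hc) (not_lt.mpr h)
  exact lt_of_le_of_ne (not_lt.mp h1) fun h2 => hy ⟨j, h2.symm⟩

lemma siteCount_site {N : ℕ} {x : Fin N → ℝ} (hx : StrictMono x) (k : Fin N) :
    siteCount x (x k) = k.val := by
  refine le_antisymm ?_ ?_
  · by_contra h
    exact lt_irrefl _ ((lt_siteCount_iff hx (x k) k).1 (not_le.mp h))
  · by_contra h
    have h' := not_le.mp h
    have := (lt_siteCount_iff hx (x k) ⟨siteCount x (x k), h'.trans k.2⟩).2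
      (hx (show (⟨siteCount x (x k), h'.trans k.2⟩ : Fin N) < k from h'))
    exact lt_irrefl _ this

lemma exists_form_on_region {N : ℕ} {x m n : Fin N → ℝ} {z : ℂ}
    {φ₁ : ℝ → ℂ} {φ₂ : ℝ → Fin 2 → ℂ} {φ₃ : ℝ → ℂ} (h : IsLaxSolution x m n z φ₁ φ₂ φ₃) (k : ℕ) :
    ∃ (α γ : ℂ) (v : Fin 2 → ℂ), ∀ y ∈ region x k,
      φ₁ y = α * Complex.exp y - γ * (Complex.exp y)⁻¹ ∧ φ₂ y = v ∧
      φ₃ y = α * Complex.exp y + γ * (Complex.exp y)⁻¹ := by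
  have hexp : ∀ y : ℝ, HasDerivAt (fun t : ℝ => Complex.exp t) (Complex.exp y) y := fun y => by
    simpa using (Complex.hasDerivAt_exp (y : ℂ)).comp_ofReal
  have hexpn : ∀ y : ℝ, HasDerivAt (fun t : ℝ => (Complex.exp t)⁻¹) (-(Complex.exp y)⁻¹) y :=
    fun y => by
      have hne := Complex.exp_ne_zero (y : ℂ)
      refine HasDerivAt.congr_deriv ((hexp y).inv hne) ?_
      rw [inv_eq_one_div]
      field_simp
  have hp : ∀ y ∈ region x k, HasDerivAt (fun t => (φ₁ t + φ₃ t) * (Complex.exp t)⁻¹) 0 y := by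
    intro y hy
    have hy' := notMem_range_of_region hy
    refine HasDerivAt.congr_deriv
      (((h.deriv_one y hy').add (h.deriv_three y hy')).mul (hexpn y)) ?_
    simp only [Pi.add_apply]
    ring
  have hm : ∀ y ∈ region x k, HasDerivAt (fun t => (φ₃ t - φ₁ t) * Complex.exp t) 0 y := by
    intro y hy
    have hy' := notMem_range_of_region hy
    refine HasDerivAt.congr_deriv
      (((h.deriv_three y hy').sub (h.deriv_one y hy')).mul (hexp y)) ?_
    simp only [Pi.sub_apply]
    ring
  have h2 : ∀ y ∈ region x k, HasDerivAt φ₂ 0 y :=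
    fun y hy => h.deriv_two y (notMem_range_of_region hy)
  obtain ⟨a, ha⟩ := (isOpen_region x k).exists_is_const_of_deriv_eq_zero
    (isPreconnected_region x k)
    (fun y hy => (hp y hy).differentiableAt.differentiableWithinAt) (fun y hy => (hp y hy).deriv)
  obtain ⟨c, hc⟩ := (isOpen_region x k).exists_is_const_of_deriv_eq_zero
    (isPreconnected_region x k)
    (fun y hy => (hm y hy).differentiableAt.differentiableWithinAt) (fun y hy => (hm y hy).deriv)
  obtain ⟨v, hv⟩ := (isOpen_region x k).exists_is_const_of_deriv_eq_zero
    (isPreconnected_region x k)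
    (fun y hy => (h2 y hy).differentiableAt.differentiableWithinAt) (fun y hy => (h2 y hy).deriv)
  refine ⟨a / 2, c / 2, v, fun y hy => ?_⟩
  have h1 := ha y hy
  have h3 := hc y hy
  have hne := Complex.exp_ne_zero (y : ℂ)
  rw [← h1, ← h3]
  refine ⟨?_, hv y hy, ?_⟩ <;> field_simp <;> ring

/-- A solution that is `a (eʸ, 0, eʸ)` to the left of all sites is given by the coefficients
`(A_k, B_k, C_k)` on the `k`-th interval. -/
theorem form_of_solution {N : ℕ} {x m n : Fin N → ℝ} (hx : StrictMono x) {z : ℂ}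
    {φ₁ : ℝ → ℂ} {φ₂ : ℝ → Fin 2 → ℂ} {φ₃ : ℝ → ℂ} (h : IsLaxSolution x m n z φ₁ φ₂ φ₃) {a : ℂ}
    (h0 : ∀ y ∈ region x 0, φ₁ y = a * Complex.exp y ∧ φ₂ y = 0 ∧ φ₃ y = a * Complex.exp y)
    (k : ℕ) (hk : k ≤ N) : ∀ y ∈ region x k,
      φ₁ y = a * (coeffVal x m n z k 0 * Complex.exp y
        - (-z ^ 2) * coeffVal x m n z k 3 * (Complex.exp y)⁻¹) ∧
      φ₂ y = (2 * z * a) • ![coeffVal x m n z k 1, coeffVal x m n z k 2] ∧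
      φ₃ y = a * (coeffVal x m n z k 0 * Complex.exp y
        + (-z ^ 2) * coeffVal x m n z k 3 * (Complex.exp y)⁻¹) := by
  induction k with
  | zero =>
    intro y hy
    obtain ⟨e1, e2, e3⟩ := h0 y hy
    have hz : (![0, 0] : Fin 2 → ℂ) = 0 := by
      funext i; fin_cases i <;> rfl
    simp [coeffVal_zero, e1, e2, e3, hz]
  | succ k ih =>
    have ih := ih (by omega)
    set j : Fin N := ⟨k, by omega⟩ with hj
    obtain ⟨α, γ, v, hform⟩ := exists_form_on_region h (k + 1)
    obtain ⟨l, r, l₁, r₁, tl, tr, tl1, tr1, ej, ej1⟩ := h.jump j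
    have hce : ∀ (p : ℝ) (s : Set ℝ), Tendsto (fun t : ℝ => Complex.exp t) (𝓝[s] p)
        (𝓝 (Complex.exp p)) := fun p s =>
      ((Complex.continuous_exp.comp Complex.continuous_ofReal).tendsto p).mono_left
        nhdsWithin_le_nhds
    have hci : ∀ (p : ℝ) (s : Set ℝ), Tendsto (fun t : ℝ => (Complex.exp t)⁻¹) (𝓝[s] p)
        (𝓝 (Complex.exp p)⁻¹) := fun p s => (hce p s).inv₀ (Complex.exp_ne_zero _)
    set E := Complex.exp (x j) with hE
    have hE0 : E ≠ 0 := Complex.exp_ne_zero _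
    obtain ⟨s0, s1, s2, s3⟩ := coeffVal_succ x m n z j E hE
    have hL : ∀ᶠ y in 𝓝[<] x j, y ∈ region x k := region_left hx j
    have hR : ∀ᶠ y in 𝓝[>] x j, y ∈ region x (k + 1) := region_right hx j
    have q3l : φ₃ (x j) = a * (coeffVal x m n z k 0 * E
        + (-z ^ 2) * coeffVal x m n z k 3 * E⁻¹) := by
      refine tendsto_nhds_unique
        ((h.continuous.tendsto (x j)).mono_left (nhdsWithin_le_nhds (s := Set.Iio (x j)))) ?_
      refine Tendsto.congr' (hL.mono fun y hy => ((ih y hy).2.2).symm) ?_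
      exact (((hce _ _).const_mul _).add ((hci _ _).const_mul _)).const_mul _
    have q3r : φ₃ (x j) = α * E + γ * E⁻¹ := by
      refine tendsto_nhds_unique
        ((h.continuous.tendsto (x j)).mono_left (nhdsWithin_le_nhds (s := Set.Ioi (x j)))) ?_
      refine Tendsto.congr' (hR.mono fun y hy => ((hform y hy).2.2).symm) ?_
      exact ((hce _ _).const_mul _).add ((hci _ _).const_mul _)
    have q1l : l₁ = a * (coeffVal x m n z k 0 * E
        - (-z ^ 2) * coeffVal x m n z k 3 * E⁻¹) := by
      refine tendsto_nhds_unique tl1 ?_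
      refine Tendsto.congr' (hL.mono fun y hy => ((ih y hy).1).symm) ?_
      exact (((hce _ _).const_mul _).sub ((hci _ _).const_mul _)).const_mul _
    have q1r : r₁ = α * E - γ * E⁻¹ := by
      refine tendsto_nhds_unique tr1 ?_
      refine Tendsto.congr' (hR.mono fun y hy => ((hform y hy).1).symm) ?_
      exact ((hce _ _).const_mul _).sub ((hci _ _).const_mul _)
    have q2l : l = (2 * z * a) • ![coeffVal x m n z k 1, coeffVal x m n z k 2] := by
      refine tendsto_nhds_unique tl ?_
      exact Tendsto.congr' (hL.mono fun y hy => ((ih y hy).2.1).symm) tendsto_const_nhds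
    have q2r : r = v := by
      refine tendsto_nhds_unique tr ?_
      exact Tendsto.congr' (hR.mono fun y hy => ((hform y hy).2.1).symm) tendsto_const_nhds
    have ev0 := congrFun ej 0
    have ev1 := congrFun ej 1
    rw [q2r, q2l] at ev0 ev1
    rw [q1r, q1l, q2r, q2l] at ej1
    simp only [pairing, Pi.sub_apply, Pi.smul_apply, Pi.add_apply, smul_eq_mul,
      Matrix.cons_val_zero, Matrix.cons_val_one] at ev0 ev1 ej1
    have hv0 : v 0 = 2 * z * a * coeffVal x m n z (k + 1) 1 := by
      rw [show k + 1 = j.val + 1 from rfl, s1]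
      rw [q3l] at ev0
      linear_combination ev0
    have hv1 : v 1 = 2 * z * a * coeffVal x m n z (k + 1) 2 := by
      rw [show k + 1 = j.val + 1 from rfl, s2]
      rw [q3l] at ev1
      linear_combination ev1
    have hEi : E * E⁻¹ = 1 := mul_inv_cancel₀ hE0
    rw [hv0, hv1, show k + 1 = j.val + 1 from rfl, s1, s2] at ej1
    rw [q3l] at q3r
    change a * (coeffVal x m n z j 0 * E + _ * coeffVal x m n z j 3 * E⁻¹) = _ at q3r
    change _ - a * (coeffVal x m n z j 0 * E - _ * coeffVal x m n z j 3 * E⁻¹) =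
      2 * z * (_ * (1 / 2 * (2 * z * a * coeffVal x m n z j 2 + _)) +
        _ * (1 / 2 * (2 * z * a * coeffVal x m n z j 1 + _))) at ej1
    have hα : α = a * coeffVal x m n z (k + 1) 0 := by
      rw [show k + 1 = j.val + 1 from rfl, s0]
      generalize coeffVal x m n z j 0 = c0 at *
      generalize coeffVal x m n z j 1 = c1 at *
      generalize coeffVal x m n z j 2 = c2 at *
      generalize coeffVal x m n z j 3 = c3 at *
      field_simp at q3r ej1 ⊢
      linear_combination (1 / 2) * ej1 - (1 / 2) * q3r
    have hγ : γ = a * ((-z ^ 2) * coeffVal x m n z (k + 1) 3) := by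
      rw [show k + 1 = j.val + 1 from rfl, s3]
      generalize coeffVal x m n z j 0 = c0 at *
      generalize coeffVal x m n z j 1 = c1 at *
      generalize coeffVal x m n z j 2 = c2 at *
      generalize coeffVal x m n z j 3 = c3 at *
      field_simp at q3r ej1 ⊢
      linear_combination -(1 / 2) * ej1 - (1 / 2) * q3r
    intro y hy
    obtain ⟨e1, e2, e3⟩ := hform y hy
    rw [hα, hγ] at e1 e3
    refine ⟨by rw [e1]; ring, ?_, by rw [e3]; ring⟩
    rw [e2]
    funext i
    fin_cases i
    · simpa using hv0
    · simpa using hv1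

/-- The explicit solution, `a (eʸ, 0, eʸ)` to the left of all sites with `a = 1`. -/
lemma exists_solution {N : ℕ} {x : Fin N → ℝ} (m n : Fin N → ℝ) (hx : StrictMono x) (z : ℂ) :
    ∃ (φ₁ : ℝ → ℂ) (φ₂ : ℝ → Fin 2 → ℂ) (φ₃ : ℝ → ℂ), IsLaxSolution x m n z φ₁ φ₂ φ₃ ∧
      ∀ k ≤ N, ∀ y ∈ region x k,
        φ₁ y = coeffVal x m n z k 0 * Complex.exp y
          - (-z ^ 2) * coeffVal x m n z k 3 * (Complex.exp y)⁻¹ ∧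
        φ₂ y = (2 * z) • ![coeffVal x m n z k 1, coeffVal x m n z k 2] ∧
        φ₃ y = coeffVal x m n z k 0 * Complex.exp y
          + (-z ^ 2) * coeffVal x m n z k 3 * (Complex.exp y)⁻¹ := by
  let F₁ : ℕ → ℝ → ℂ := fun k y => coeffVal x m n z k 0 * Complex.exp y
    - (-z ^ 2) * coeffVal x m n z k 3 * (Complex.exp y)⁻¹
  let F₂ : ℕ → Fin 2 → ℂ := fun k => (2 * z) • ![coeffVal x m n z k 1, coeffVal x m n z k 2]
  let F₃ : ℕ → ℝ → ℂ := fun k y => coeffVal x m n z k 0 * Complex.exp y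
    + (-z ^ 2) * coeffVal x m n z k 3 * (Complex.exp y)⁻¹
  have hexp : ∀ y : ℝ, HasDerivAt (fun t : ℝ => Complex.exp t) (Complex.exp y) y := fun y => by
    simpa using (Complex.hasDerivAt_exp (y : ℂ)).comp_ofReal
  have hexpn : ∀ y : ℝ, HasDerivAt (fun t : ℝ => (Complex.exp t)⁻¹) (-(Complex.exp y)⁻¹) y :=
    fun y => by
      have hne := Complex.exp_ne_zero (y : ℂ)
      refine HasDerivAt.congr_deriv ((hexp y).inv hne) ?_
      rw [inv_eq_one_div]
      field_simp
  have d1 : ∀ k y, HasDerivAt (F₁ k) (F₃ k y) y := fun k y => by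
    refine HasDerivAt.congr_deriv (((hexp y).const_mul (coeffVal x m n z k 0)).sub
      ((hexpn y).const_mul ((-z ^ 2) * coeffVal x m n z k 3))) ?_
    simp only [F₃]
    ring
  have d3 : ∀ k y, HasDerivAt (F₃ k) (F₁ k y) y := fun k y => by
    refine HasDerivAt.congr_deriv (((hexp y).const_mul (coeffVal x m n z k 0)).add
      ((hexpn y).const_mul ((-z ^ 2) * coeffVal x m n z k 3))) ?_
    simp only [F₁]
    ring
  have loc : ∀ y, y ∉ Set.range x → ∀ᶠ t in 𝓝 y, siteCount x t = siteCount x y := fun y hy => by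
    filter_upwards [(isOpen_region x _).mem_nhds (mem_region_siteCount hx hy)] with t ht
    exact siteCount_eq hx (siteCount_le x y) ht
  have hL : ∀ k : Fin N, ∀ᶠ t in 𝓝[<] x k, siteCount x t = k.val := fun k =>
    (region_left hx k).mono fun t ht => siteCount_eq hx k.2.le ht
  have hR : ∀ k : Fin N, ∀ᶠ t in 𝓝[>] x k, siteCount x t = k.val + 1 := fun k =>
    (region_right hx k).mono fun t ht => siteCount_eq hx k.2 ht
  have match3 : ∀ k : Fin N, F₃ (k.val + 1) (x k) = F₃ k.val (x k) := fun k => by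
    obtain ⟨s0, s1, s2, s3⟩ := coeffVal_succ x m n z k _ rfl
    have hne := Complex.exp_ne_zero (x k : ℂ)
    simp only [F₃, s0, s3]
    field_simp
    ring
  refine ⟨fun y => F₁ (siteCount x y) y, fun y => F₂ (siteCount x y),
    fun y => F₃ (siteCount x y) y, ⟨?_, ?_, ?_, ?_, ?_⟩, ?_⟩
  · rw [continuous_iff_continuousAt]
    intro y
    by_cases hy : y ∈ Set.range x
    · obtain ⟨k, rfl⟩ := hy
      rw [continuousAt_iff_continuous_left'_right']
      have hk := siteCount_site hx k
      constructor
      · simp only [ContinuousWithinAt, hk]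
        refine Tendsto.congr' ?_ ((d3 k.val (x k)).continuousAt.tendsto.mono_left
          nhdsWithin_le_nhds)
        filter_upwards [hL k] with t ht
        rw [ht]
      · simp only [ContinuousWithinAt, hk, ← match3 k]
        refine Tendsto.congr' ?_ ((d3 (k.val + 1) (x k)).continuousAt.tendsto.mono_left
          nhdsWithin_le_nhds)
        filter_upwards [hR k] with t ht
        rw [ht]
    · refine (d3 (siteCount x y) y).continuousAt.congr ?_
      filter_upwards [loc y hy] with t ht
      rw [ht]
  · intro y hy
    refine (d1 (siteCount x y) y).congr_of_eventuallyEq ?_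
    filter_upwards [loc y hy] with t ht
    rw [ht]
  · intro y hy
    refine (hasDerivAt_const y (F₂ (siteCount x y))).congr_of_eventuallyEq ?_
    filter_upwards [loc y hy] with t ht
    rw [ht]
  · intro y hy
    refine (d3 (siteCount x y) y).congr_of_eventuallyEq ?_
    filter_upwards [loc y hy] with t ht
    rw [ht]
  · intro k
    obtain ⟨s0, s1, s2, s3⟩ := coeffVal_succ x m n z k _ rfl
    have hne := Complex.exp_ne_zero (x k : ℂ)
    refine ⟨F₂ k.val, F₂ (k.val + 1), F₁ k.val (x k), F₁ (k.val + 1) (x k), ?_, ?_, ?_, ?_, ?_, ?_⟩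
    · refine Tendsto.congr' ?_ tendsto_const_nhds
      filter_upwards [hL k] with t ht
      rw [ht]
    · refine Tendsto.congr' ?_ tendsto_const_nhds
      filter_upwards [hR k] with t ht
      rw [ht]
    · refine Tendsto.congr' ?_ ((d1 k.val (x k)).continuousAt.tendsto.mono_left
          nhdsWithin_le_nhds)
      filter_upwards [hL k] with t ht
      rw [ht]
    · refine Tendsto.congr' ?_ ((d1 (k.val + 1) (x k)).continuousAt.tendsto.mono_left
          nhdsWithin_le_nhds)
      filter_upwards [hR k] with t ht
      rw [ht]
    · rw [siteCount_site hx k]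
      funext i
      fin_cases i
      · simp [F₂, F₃, s1]
        ring
      · simp [F₂, F₃, s2]
        ring
    · simp only [F₁, F₂, pairing, s0, s1, s2, s3, Pi.smul_apply, Pi.add_apply, smul_eq_mul,
        Matrix.cons_val_zero, Matrix.cons_val_one]
      field_simp
      ring
  · intro k hk y hy
    have := siteCount_eq hx hk hy
    simp only [this]
    exact ⟨rfl, rfl, rfl⟩

lemma region_zero_atBot {N : ℕ} (x : Fin N → ℝ) : ∀ᶠ y in atBot, y ∈ region x 0 := by
  refine eventually_all.2 fun j => ?_
  filter_upwards [eventually_lt_atBot (x j)] with y hy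
  exact ⟨fun h => absurd h (Nat.not_lt_zero _), fun _ => hy⟩

lemma region_last_atTop {N : ℕ} (x : Fin N → ℝ) : ∀ᶠ y in atTop, y ∈ region x N := by
  refine eventually_all.2 fun j => ?_
  filter_upwards [eventually_gt_atTop (x j)] with y hy
  exact ⟨fun _ => hy, fun h => absurd j.2 (not_lt.mpr h)⟩

/-- `z` is an eigenvalue of the boundary value problem if and only if `A(-z²) = 0`. -/
theorem isLaxEigenvalue_iff {N : ℕ} {x : Fin N → ℝ} (m n : Fin N → ℝ) (hx : StrictMono x) (z : ℂ) :
    IsLaxEigenvalue x m n z ↔ aeval (-z ^ 2) (polyA x m n) = 0 := by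
  have eBot : Tendsto (fun y : ℝ => Complex.exp y) atBot (𝓝 0) := by
    rw [tendsto_zero_iff_norm_tendsto_zero]
    simpa [Complex.norm_exp] using Real.tendsto_exp_atBot
  have eTop : Tendsto (fun y : ℝ => (Complex.exp y)⁻¹) atTop (𝓝 0) := by
    rw [tendsto_zero_iff_norm_tendsto_zero]
    have := Real.tendsto_exp_atTop.inv_tendsto_atTop
    simpa [Complex.norm_exp, Pi.inv_def] using this
  constructor
  · rintro ⟨φ₁, φ₂, φ₃, h, ⟨y0, hy0, hne⟩, b3, b2, t3⟩
    obtain ⟨α, γ, v, hform⟩ := exists_form_on_region h 0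
    have hv : v = 0 := by
      refine tendsto_nhds_unique ?_ b2
      exact Tendsto.congr' ((region_zero_atBot x).mono fun y hy => ((hform y hy).2.1).symm)
        tendsto_const_nhds
    have hγ : γ = 0 := by
      have h1 : Tendsto (fun y : ℝ => φ₃ y * Complex.exp y - α * Complex.exp y * Complex.exp y)
          atBot (𝓝 (0 * 0 - α * 0 * 0)) := (b3.mul eBot).sub ((eBot.const_mul α).mul eBot)
      have h2 : Tendsto (fun y : ℝ => φ₃ y * Complex.exp y - α * Complex.exp y * Complex.exp y)
          atBot (𝓝 γ) := by
        refine Tendsto.congr' ((region_zero_atBot x).mono fun y hy => ?_) tendsto_const_nhds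
        have hne := Complex.exp_ne_zero (y : ℂ)
        simp only [(hform y hy).2.2]
        field_simp
        ring
      simpa using tendsto_nhds_unique h2 h1
    subst hv hγ
    have hall := form_of_solution hx h (a := α) (fun y hy => by
      obtain ⟨e1, e2, e3⟩ := hform y hy
      exact ⟨by rw [e1]; ring, e2, by rw [e3]; ring⟩)
    have hα : α ≠ 0 := by
      rintro rfl
      obtain ⟨e1, e2, e3⟩ := hall _ (siteCount_le x y0) y0 (mem_region_siteCount hx hy0)
      simp [e1, e2, e3] at hne
    have h1 : Tendsto (fun y : ℝ => φ₃ y * (Complex.exp y)⁻¹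
        - α * ((-z ^ 2) * coeffVal x m n z N 3) * (Complex.exp y)⁻¹ * (Complex.exp y)⁻¹)
        atTop (𝓝 (0 * 0 - α * ((-z ^ 2) * coeffVal x m n z N 3) * 0 * 0)) :=
      (t3.mul eTop).sub ((eTop.const_mul _).mul eTop)
    have h2 : Tendsto (fun y : ℝ => φ₃ y * (Complex.exp y)⁻¹
        - α * ((-z ^ 2) * coeffVal x m n z N 3) * (Complex.exp y)⁻¹ * (Complex.exp y)⁻¹)
        atTop (𝓝 (α * coeffVal x m n z N 0)) := by
      refine Tendsto.congr' ((region_last_atTop x).mono fun y hy => ?_) tendsto_const_nhds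
      have hne := Complex.exp_ne_zero (y : ℂ)
      simp only [(hall N le_rfl y hy).2.2]
      field_simp
      ring
    have h3 := tendsto_nhds_unique h2 h1
    simpa [hα, coeffVal, polyA] using h3
  · intro hA
    have hA' : coeffVal x m n z N 0 = 0 := hA
    obtain ⟨φ₁, φ₂, φ₃, h, hf⟩ := exists_solution m n hx z
    refine ⟨φ₁, φ₂, φ₃, h, ?_, ?_, ?_, ?_⟩
    · obtain ⟨y, hy⟩ := (region_zero_atBot x).exists
      refine ⟨y, notMem_range_of_region hy, Or.inl ?_⟩
      rw [(hf 0 (Nat.zero_le _) y hy).1]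
      simp [coeffVal_zero]
    · refine Tendsto.congr' ((region_zero_atBot x).mono fun y hy => ?_) eBot
      rw [(hf 0 (Nat.zero_le _) y hy).2.2]
      simp [coeffVal_zero]
    · refine Tendsto.congr' ((region_zero_atBot x).mono fun y hy => ?_) tendsto_const_nhds
      rw [(hf 0 (Nat.zero_le _) y hy).2.1]
      funext i
      fin_cases i <;> simp [coeffVal_zero]
    · have := eTop.const_mul ((-z ^ 2) * coeffVal x m n z N 3)
      rw [mul_zero] at this
      refine Tendsto.congr' ((region_last_atTop x).mono fun y hy => ?_) this
      rw [(hf N le_rfl y hy).2.2, hA']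
      ring

end NovikovPeakon

end

/-! By `isLaxEigenvalue_iff` the eigenvalues are the `z` with A(-z²) = 0, so everything rests on the
zeros of A and on the values of B and C there. The zeros are followed from site to site. Write E =
e^y and let f = A E + λ C / E be the third component at y. A site leaves f unchanged, adds m f and n
f to B₁ and B₂, and subtracts (λ/E)(2mnf + 2(nB₁ + mB₂)) from A.

Suppose that A_k has k simple positive zeros and that B₁, B₂ have the sign (-1)^i at the i-th of
them, counted upwards from 0. A bilinear relation between λ and -λ (`coeffEval_symmetry`), together
with A > 0 and B ≥ 0 on the negative half-line, gives (-1)^i C ≥ 0 there. Hence A_{k+1} has the sign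
(-1)^(i+1) at that zero. With A_{k+1}(0) = 1 and the sign of the top coefficient, the intermediate
value theorem yields k+1 zeros interlacing with the old ones (`exists_interlacing_roots`).

To carry the signs of B to the new zeros, take λ > 0. The energy A E f + 2λB₁B₂ is conserved at
sites and does not decrease between them, so it stays positive. At a zero of the new A it equals
2λB₁B₂, so B₁ and B₂ have a common sign. That this is the sign of the old A follows from a second
property kept along the line: if A f < 0, then B₁ and B₂ have the sign of f (`energy_pos_and_sign`,
`sign_at_zero`).

The alternation of B makes the residues of W positive. At λ_k, where A vanishes, the bilinear
relation expresses C(λ_k) through W(-λ_k); this is the formula for c_k, and it shows c_k > 0. -/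

namespace NovikovPeakon

/-! ### Passing a site at a real spectral value -/

/-- The vector `(A_k, B_k, C_k)` evaluated at the real number `s`. -/
noncomputable def coeffEval {N : ℕ} (x m n : Fin N → ℝ) (k : ℕ) (s : ℝ) (i : Fin 4) : ℝ :=
  (coeffVec x m n k i).eval s

lemma coeffVec_succ {N : ℕ} (x m n : Fin N → ℝ) (k : Fin N) (i : Fin 4) :
    coeffVec x m n (k.val + 1) i =
      (stepMatrix (x k) (m k) (n k)).mulVec (coeffVec x m n k) i := by
  simp [coeffVec]

lemma coeffEval_zero {N : ℕ} (x m n : Fin N → ℝ) (s : ℝ) :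
    coeffEval x m n 0 s 0 = 1 ∧ coeffEval x m n 0 s 1 = 0 ∧ coeffEval x m n 0 s 2 = 0 ∧
      coeffEval x m n 0 s 3 = 0 := by
  simp [coeffEval, coeffVec]

/-- Passing a site, in terms of the value `f` of the third component at the site. -/
lemma coeffEval_succ {N : ℕ} (x m n : Fin N → ℝ) (k : Fin N) (s : ℝ) {E f : ℝ}
    (hE : E = Real.exp (x k))
    (hf : f = coeffEval x m n k s 0 * E + s * coeffEval x m n k s 3 / E) :
    coeffEval x m n (k.val + 1) s 0 = coeffEval x m n k s 0 - s / E * (2 * m k * n k * f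
        + 2 * (n k * coeffEval x m n k s 1 + m k * coeffEval x m n k s 2)) ∧
    coeffEval x m n (k.val + 1) s 1 = coeffEval x m n k s 1 + m k * f ∧
    coeffEval x m n (k.val + 1) s 2 = coeffEval x m n k s 2 + n k * f ∧
    coeffEval x m n (k.val + 1) s 3 = coeffEval x m n k s 3 + E * (2 * m k * n k * f
        + 2 * (n k * coeffEval x m n k s 1 + m k * coeffEval x m n k s 2)) := by
  have h0 : E ≠ 0 := hE ▸ Real.exp_ne_zero _
  have h1 : Real.exp (-x k) = E⁻¹ := by rw [hE, Real.exp_neg]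
  have h2 : Real.exp (2 * x k) = E ^ 2 := by rw [hE, ← Real.exp_nat_mul]; norm_num
  have h3 : Real.exp (-2 * x k) = (E⁻¹) ^ 2 := by
    rw [neg_mul, Real.exp_neg, h2, inv_pow]
  subst hf
  refine ⟨?_, ?_, ?_, ?_⟩ <;>
  · simp only [coeffEval, coeffVec_succ, stepMatrix, Matrix.mulVec, dotProduct,
      Fin.sum_univ_four, pairing, h1, h2, h3, ← hE]
    simp
    field_simp
    ring

/-! ### Energy and signs for positive spectral values -/

/-- Passing a site does not lead to `B₁`, `B₂` having the sign of `A` opposite to that of `f`. -/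
lemma sign_of_site {A B D A' B' D' E f s μ ν : ℝ} (hE : 0 < E) (hs : 0 < s) (hμ : 0 < μ)
    (hν : 0 < ν) (e0 : A' = A - s / E * (2 * μ * ν * f + 2 * (ν * B + μ * D)))
    (e1 : B' = B + μ * f) (e2 : D' = D + ν * f)
    (hen : 0 < A' * E * f + 2 * s * B' * D') (hq : A * f < 0 → 0 < B * f ∧ 0 < D * f)
    (hneg : A' * f < 0) : 0 < B' * f ∧ 0 < D' * f := by
  have hprod : 0 < B' * D' := by
    have h1 : A' * f * E < 0 := mul_neg_of_neg_of_pos hneg hE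
    have h2 : 0 < 2 * s * (B' * D') := by linarith
    exact pos_of_mul_pos_right h2 (by positivity)
  have hf2 : 0 < f ^ 2 := by
    have : f ≠ 0 := by rintro rfl; simp at hneg
    positivity
  have hpp : 0 < (B' * f) * (D' * f) := by
    have := mul_pos hprod hf2
    linarith
  rcases pos_and_pos_or_neg_and_neg_of_mul_pos hpp with h | ⟨hb, hd⟩
  · exact h
  -- The remaining case, B' and D' both of sign opposite to f, is impossible: B and D then have that
  -- sign as well. The increment of A is the sum of the values before and after the site, so A f < 0
  -- too, and `hq` is contradicted.
  have hB : B * f = B' * f - μ * f ^ 2 := by rw [e1]; ring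
  have hD : D * f = D' * f - ν * f ^ 2 := by rw [e2]; ring
  have hBn : B * f < 0 := by
    have := mul_pos hμ hf2
    linarith
  have hDn : D * f < 0 := by
    have := mul_pos hν hf2
    linarith
  have hA : A * f = A' * f + s / E * (ν * (B * f) + μ * (D * f) + ν * (B' * f)
      + μ * (D' * f)) := by rw [e0, e1, e2]; ring
  have hsum : ν * (B * f) + μ * (D * f) + ν * (B' * f) + μ * (D' * f) < 0 := by
    have h1 := mul_neg_of_pos_of_neg hν hBn
    have h2 := mul_neg_of_pos_of_neg hμ hDn
    have h3 := mul_neg_of_pos_of_neg hν hb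
    have h4 := mul_neg_of_pos_of_neg hμ hd
    linarith
  have := mul_neg_of_pos_of_neg (div_pos hs hE) hsum
  have := (hq (by linarith)).1
  linarith

/-- The energy grows from `E` to `F` between two sites, and a sign change of `f` there leads from
the sign opposite to that of `A` to the sign of `A`. -/
lemma sign_of_gap {A B C D E F f g s : ℝ} (hE : 0 < E) (hEF : E ≤ F)
    (hf : f = A * E + s * C / E) (hg : g = A * F + s * C / F)
    (hen : 0 < A * E * f + 2 * s * B * D) (hq : A * f < 0 → 0 < B * f ∧ 0 < D * f) :
    0 < A * F * g + 2 * s * B * D ∧ (A * g < 0 → 0 < B * g ∧ 0 < D * g) := by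
  have hF : 0 < F := hE.trans_le hEF
  -- A and C are constant between sites, so the energy grows by A²(F² - E²).
  have hgF : g * F = f * E + A * (F ^ 2 - E ^ 2) := by
    rw [hg, hf]; field_simp; ring
  have hFE : 0 ≤ F ^ 2 - E ^ 2 := sub_nonneg.2 (pow_le_pow_left₀ hE.le hEF 2)
  have hmono : A * E * f ≤ A * F * g := by
    have h1 : A * F * g = A * E * f + A ^ 2 * (F ^ 2 - E ^ 2) := by
      linear_combination A * hgF
    have := mul_nonneg (sq_nonneg A) hFE
    linarith
  refine ⟨by linarith, fun hneg => ?_⟩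
  -- Since E A f ≤ F A g, a negative A g comes from a negative A f. Then f and g have the same sign,
  -- and the claim at f passes to g.
  have hneg' : A * f < 0 := by
    have h1 : F * (A * g) < 0 := mul_neg_of_pos_of_neg hF hneg
    have h2 : E * (A * f) < 0 := by linarith
    exact neg_of_mul_neg_right h2 hE.le
  obtain ⟨h1, h2⟩ := hq hneg'
  have hfg : 0 < f * g := by
    have h3 : 0 < A ^ 2 * (f * g) := by
      have := mul_pos_of_neg_of_neg hneg hneg'
      linarith
    exact pos_of_mul_pos_right h3 (sq_nonneg _)
  constructor
  · have : 0 < f ^ 2 * (B * g) := by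
      have := mul_pos h1 hfg
      linarith
    exact pos_of_mul_pos_right this (sq_nonneg _)
  · have : 0 < f ^ 2 * (D * g) := by
      have := mul_pos h2 hfg
      linarith
    exact pos_of_mul_pos_right this (sq_nonneg _)

/-- The energy `A E f + 2 s B₁ B₂` is positive, and if `A` and `f` have opposite signs, then
`B₁` and `B₂` have the sign of `f`. -/
lemma energy_pos_and_sign {N : ℕ} {x m n : Fin N → ℝ} (hx : StrictMono x)
    (hm : ∀ j, 0 < m j) (hn : ∀ j, 0 < n j) {s : ℝ} (hs : 0 < s) {k : ℕ} (hk : k ≤ N) :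
    ∀ E f : ℝ, 0 < E → (∀ j : Fin N, j.val < k → Real.exp (x j) ≤ E) →
      f = coeffEval x m n k s 0 * E + s * coeffEval x m n k s 3 / E →
      0 < coeffEval x m n k s 0 * E * f + 2 * s * coeffEval x m n k s 1 * coeffEval x m n k s 2 ∧
      (coeffEval x m n k s 0 * f < 0 →
        0 < coeffEval x m n k s 1 * f ∧ 0 < coeffEval x m n k s 2 * f) := by
  -- `E` is e^y for a point y at or beyond the last site passed. Keeping it arbitrary lets the
  -- induction hypothesis be used at the next site.
  induction k with
  | zero =>
    intro E f hE _ hf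
    obtain ⟨h0, h1, h2, h3⟩ := coeffEval_zero x m n s
    rw [h0, h3] at hf
    rw [h0, h1, h2]
    have hf' : f = E := by rw [hf]; ring
    subst hf'
    refine ⟨by simpa using mul_pos hE hE, fun h => ?_⟩
    linarith
  | succ k ih =>
    intro F g hF hle hg
    set j : Fin N := ⟨k, hk⟩ with hj
    obtain ⟨E, hE⟩ : ∃ E, E = Real.exp (x j) := ⟨_, rfl⟩
    have hE0 : 0 < E := hE ▸ Real.exp_pos _
    have hEF : E ≤ F := hE ▸ hle j (Nat.lt_succ_self k)
    obtain ⟨f, hf⟩ : ∃ f, f = coeffEval x m n k s 0 * E + s * coeffEval x m n k s 3 / E := ⟨_, rfl⟩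
    obtain ⟨e0, e1, e2, e3⟩ := coeffEval_succ x m n j s hE hf
    simp only [hj] at e0 e1 e2 e3
    rw [← hj] at e0 e1 e2 e3
    obtain ⟨p, q⟩ := ih (Nat.le_of_succ_le hk) E f hE0
      (fun i hi => hE ▸ (Real.exp_le_exp.2 (hx.monotone (show i ≤ j from hi.le)))) hf
    -- The third component is continuous: the jumps of A and C cancel in it.
    have hcont : f = coeffEval x m n (k + 1) s 0 * E + s * coeffEval x m n (k + 1) s 3 / E := by
      rw [e0, e3, hf]; field_simp; ring
    -- The energy is conserved: the loss in A E f is the gain in 2 s B₁ B₂.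
    have hen : coeffEval x m n (k + 1) s 0 * E * f
        + 2 * s * coeffEval x m n (k + 1) s 1 * coeffEval x m n (k + 1) s 2 =
        coeffEval x m n k s 0 * E * f
        + 2 * s * coeffEval x m n k s 1 * coeffEval x m n k s 2 := by
      rw [e0, e1, e2]; field_simp; ring
    rw [← hen] at p
    exact sign_of_gap hE0 hEF hcont hg p (sign_of_site hE0 hs (hm j) (hn j) e0 e1 e2 p q)

/-! ### Negative spectral values and the relation between λ and -λ -/

/-- On the negative half-line `A` is positive and `B` and `C` are nonnegative. -/
lemma coeffEval_neg_sign {N : ℕ} {x m n : Fin N → ℝ} (hx : StrictMono x)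
    (hm : ∀ j, 0 < m j) (hn : ∀ j, 0 < n j) {s : ℝ} (hs : 0 < s) {k : ℕ} (hk : k ≤ N) :
    0 < coeffEval x m n k (-s) 0 ∧ 0 ≤ coeffEval x m n k (-s) 1 ∧
    0 ≤ coeffEval x m n k (-s) 2 ∧ 0 ≤ coeffEval x m n k (-s) 3 ∧
    ∀ E : ℝ, 0 < E → (∀ j : Fin N, j.val < k → Real.exp (x j) ≤ E) →
      0 < coeffEval x m n k (-s) 0 * E + -s * coeffEval x m n k (-s) 3 / E := by
  induction k with
  | zero =>
    obtain ⟨h0, h1, h2, h3⟩ := coeffEval_zero x m n (-s)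
    rw [h0, h1, h2, h3]
    exact ⟨one_pos, le_rfl, le_rfl, le_rfl, fun E hE _ => by simpa using hE⟩
  | succ k ih =>
    set j : Fin N := ⟨k, hk⟩ with hj
    obtain ⟨E, hE⟩ : ∃ E, E = Real.exp (x j) := ⟨_, rfl⟩
    have hE0 : 0 < E := hE ▸ Real.exp_pos _
    obtain ⟨f, hf⟩ : ∃ f, f = coeffEval x m n k (-s) 0 * E + -s * coeffEval x m n k (-s) 3 / E :=
      ⟨_, rfl⟩
    obtain ⟨e0, e1, e2, e3⟩ := coeffEval_succ x m n j (-s) hE hf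
    obtain ⟨a, b, d, c, p⟩ := ih (Nat.le_of_succ_le hk)
    have hfp := p E hE0
      (fun i hi => hE ▸ (Real.exp_le_exp.2 (hx.monotone (show i ≤ j from hi.le))))
    rw [← hf] at hfp
    have hm := hm j
    have hn := hn j
    simp only [hj] at e0 e1 e2 e3
    rw [← hj] at e0 e1 e2 e3
    have hcont : f = coeffEval x m n (k + 1) (-s) 0 * E
        + -s * coeffEval x m n (k + 1) (-s) 3 / E := by
      rw [e0, e3, hf]; field_simp; ring
    have hinc : 0 ≤ 2 * m j * n j * f
        + 2 * (n j * coeffEval x m n k (-s) 1 + m j * coeffEval x m n k (-s) 2) := by positivity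
    -- At -s the increment of A has the opposite sign to the one at s, so A grows.
    have hA : 0 < coeffEval x m n (k + 1) (-s) 0 := by
      rw [e0, neg_div, neg_mul, sub_neg_eq_add]
      have := mul_nonneg (div_pos hs hE0).le hinc
      linarith
    have hC : 0 ≤ coeffEval x m n (k + 1) (-s) 3 := by rw [e3]; positivity
    refine ⟨hA, by rw [e1]; positivity, by rw [e2]; positivity, hC, fun F hF hle => ?_⟩
    have hEF : E ≤ F := hE ▸ hle j (Nat.lt_succ_self k)
    -- Beyond the site A F does not decrease and s C / F does not increase, so the third component
    -- stays positive.
    refine lt_of_lt_of_le hfp ?_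
    rw [hcont]
    have h1 := mul_le_mul_of_nonneg_left hEF hA.le
    have h2 : s * coeffEval x m n (k + 1) (-s) 3 / F ≤ s * coeffEval x m n (k + 1) (-s) 3 / E :=
      div_le_div_of_nonneg_left (by positivity) hE0 hEF
    simp only [neg_mul, neg_div]
    linarith

/-- The quadratic form preserved by the transition matrices. -/
lemma coeffEval_symmetry {N : ℕ} (x m n : Fin N → ℝ) (s : ℝ) {k : ℕ} (hk : k ≤ N) :
    coeffEval x m n k s 3 * coeffEval x m n k (-s) 0
      + coeffEval x m n k (-s) 3 * coeffEval x m n k s 0 =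
    2 * (coeffEval x m n k s 1 * coeffEval x m n k (-s) 2
      + coeffEval x m n k s 2 * coeffEval x m n k (-s) 1) := by
  induction k with
  | zero =>
    obtain ⟨h0, h1, h2, h3⟩ := coeffEval_zero x m n s
    obtain ⟨h0', h1', h2', h3'⟩ := coeffEval_zero x m n (-s)
    rw [h1, h2, h3, h3']; ring
  | succ k ih =>
    obtain ⟨e0, e1, e2, e3⟩ := coeffEval_succ x m n ⟨k, hk⟩ s rfl rfl
    obtain ⟨d0, d1, d2, d3⟩ := coeffEval_succ x m n ⟨k, hk⟩ (-s) rfl rfl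
    have ih := ih (Nat.le_of_succ_le hk)
    simp only at e0 e1 e2 e3 d0 d1 d2 d3
    have hE := Real.exp_ne_zero (x ⟨k, hk⟩)
    rw [e0, e1, e2, e3, d0, d1, d2, d3]
    field_simp
    -- The difference of the two sides is unchanged by a site; the square of the exponential is the
    -- cleared denominator.
    linear_combination Real.exp (x ⟨k, hk⟩) ^ 2 * ih

/-! ### Degrees and the top coefficient of A -/

/-- Passing a site, in terms of coefficients. -/
lemma coeffVec_succ_coeff {N : ℕ} (x m n : Fin N → ℝ) (k : Fin N) (i : ℕ) {E f : ℝ}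
    (hE : E = Real.exp (x k))
    (hf : f = (coeffVec x m n k 0).coeff i * E + (X * coeffVec x m n k 3).coeff i / E) :
    (coeffVec x m n (k.val + 1) 0).coeff (i + 1) = (coeffVec x m n k 0).coeff (i + 1)
      - (2 * m k * n k * f + 2 * (n k * (coeffVec x m n k 1).coeff i
        + m k * (coeffVec x m n k 2).coeff i)) / E ∧
    (coeffVec x m n (k.val + 1) 1).coeff i = (coeffVec x m n k 1).coeff i + m k * f ∧
    (coeffVec x m n (k.val + 1) 2).coeff i = (coeffVec x m n k 2).coeff i + n k * f ∧
    (coeffVec x m n (k.val + 1) 3).coeff i = (coeffVec x m n k 3).coeff i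
      + E * (2 * m k * n k * f + 2 * (n k * (coeffVec x m n k 1).coeff i
        + m k * (coeffVec x m n k 2).coeff i)) := by
  -- `F` is the third component at the site as a polynomial in λ, and `G` is the increment common to
  -- A and C. The polynomial identities follow from those at every real number.
  set F : ℝ[X] := C E * coeffVec x m n k 0 + C E⁻¹ * (X * coeffVec x m n k 3) with hF
  set G : ℝ[X] := C (2 * m k * n k) * F
    + C 2 * (C (n k) * coeffVec x m n k 1 + C (m k) * coeffVec x m n k 2) with hG
  have hFi : F.coeff i = f := by
    rw [hF, coeff_add, coeff_C_mul, coeff_C_mul, hf]; ring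
  have hGi : G.coeff i = 2 * m k * n k * f + 2 * (n k * (coeffVec x m n k 1).coeff i
      + m k * (coeffVec x m n k 2).coeff i) := by
    simp only [hG, coeff_add, coeff_C_mul, hFi]
  have key := fun s : ℝ => coeffEval_succ x m n k s hE rfl
  simp only [coeffEval] at key
  have h0 : coeffVec x m n (k.val + 1) 0 = coeffVec x m n k 0 - C E⁻¹ * (X * G) := by
    refine Polynomial.funext fun s => ?_
    rw [(key s).1]; simp only [hG, hF, eval_add, eval_sub, eval_mul, eval_C, eval_X]; ring
  have h1 : coeffVec x m n (k.val + 1) 1 = coeffVec x m n k 1 + C (m k) * F := by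
    refine Polynomial.funext fun s => ?_
    rw [(key s).2.1]; simp only [hF, eval_add, eval_mul, eval_C, eval_X]; ring
  have h2 : coeffVec x m n (k.val + 1) 2 = coeffVec x m n k 2 + C (n k) * F := by
    refine Polynomial.funext fun s => ?_
    rw [(key s).2.2.1]; simp only [hF, eval_add, eval_mul, eval_C, eval_X]; ring
  have h3 : coeffVec x m n (k.val + 1) 3 = coeffVec x m n k 3 + C E * G := by
    refine Polynomial.funext fun s => ?_
    rw [(key s).2.2.2]; simp only [hG, hF, eval_add, eval_mul, eval_C, eval_X]; ring
  rw [h0, h1, h2, h3]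
  simp only [coeff_sub, coeff_add, coeff_C_mul, coeff_X_mul, hFi, hGi]
  refine ⟨by ring, trivial, trivial, trivial⟩

/-- A site adds to B and C polynomials of degree at most k, and to A such a polynomial times λ. At k
= 0 the last three bounds say that B and C vanish. -/
lemma coeffVec_coeff_eq_zero {N : ℕ} (x m n : Fin N → ℝ) {k : ℕ} (hk : k ≤ N) :
    (∀ i, k < i → (coeffVec x m n k 0).coeff i = 0) ∧
    (∀ i, k ≤ i → (coeffVec x m n k 1).coeff i = 0) ∧
    (∀ i, k ≤ i → (coeffVec x m n k 2).coeff i = 0) ∧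
    (∀ i, k ≤ i → (coeffVec x m n k 3).coeff i = 0) := by
  induction k with
  | zero =>
    refine ⟨fun i hi => ?_, fun i _ => ?_, fun i _ => ?_, fun i _ => ?_⟩
    · simp [coeffVec, coeff_one, hi.ne']
    all_goals simp [coeffVec]
  | succ k ih =>
    obtain ⟨a, b, d, c⟩ := ih (Nat.le_of_succ_le hk)
    have key := fun i => coeffVec_succ_coeff x m n ⟨k, hk⟩ i rfl rfl
    simp only at key
    have hX : ∀ i, k < i → (X * coeffVec x m n k 3).coeff i = 0 := by
      rintro (_ | i) hi
      · omega
      · rw [coeff_X_mul, c i (by omega)]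
    refine ⟨fun i hi => ?_, fun i hi => ?_, fun i hi => ?_, fun i hi => ?_⟩
    · obtain ⟨i, rfl⟩ : ∃ l, i = l + 1 := ⟨i - 1, by omega⟩
      rw [(key i).1, a (i + 1) (by omega), a i (by omega), b i (by omega), d i (by omega),
        hX i (by omega)]
      simp
    · rw [(key i).2.1, a i hi, b i (by omega), hX i hi]; simp
    · rw [(key i).2.2.1, a i hi, d i (by omega), hX i hi]; simp
    · rw [(key i).2.2.2, a i hi, b i (by omega), c i (by omega), d i (by omega), hX i hi]; simp

/-- The top coefficient of A_{k+1} is a negative multiple of that of f at the site. The latter must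
not vanish, so it is followed along: beyond a site at E it carries the factor F² - E², which is
positive because the sites are distinct. -/
lemma sign_leading_coeff {N : ℕ} {x m n : Fin N → ℝ} (hx : StrictMono x)
    (hm : ∀ j, 0 < m j) (hn : ∀ j, 0 < n j) {k : ℕ} (hk : k ≤ N) :
    0 < (-1) ^ k * (coeffVec x m n k 0).coeff k ∧
    ∀ E : ℝ, 0 < E → (∀ j : Fin N, j.val < k → Real.exp (x j) < E) →
      0 < (-1) ^ k * ((coeffVec x m n k 0).coeff k * E
        + (X * coeffVec x m n k 3).coeff k / E) := by
  induction k with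
  | zero => simp [coeffVec]
  | succ k ih =>
    obtain ⟨-, p⟩ := ih (Nat.le_of_succ_le hk)
    obtain ⟨a, b, d, c⟩ := coeffVec_coeff_eq_zero x m n (Nat.le_of_succ_le hk)
    set j : Fin N := ⟨k, hk⟩ with hj
    obtain ⟨E, hE⟩ : ∃ E, E = Real.exp (x j) := ⟨_, rfl⟩
    have hE0 : 0 < E := hE ▸ Real.exp_pos _
    obtain ⟨f, hf⟩ : ∃ f, f = (coeffVec x m n k 0).coeff k * E
      + (X * coeffVec x m n k 3).coeff k / E := ⟨_, rfl⟩
    have hfp := p E hE0 (fun i hi => hE ▸ (Real.exp_lt_exp.2 (hx (show i < j from hi))))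
    rw [← hf] at hfp
    obtain ⟨e0, -, -, e3⟩ := coeffVec_succ_coeff x m n j k hE hf
    simp only [hj] at e0 e3
    rw [← hj] at e0 e3
    rw [a (k + 1) (by omega), b k le_rfl, d k le_rfl] at e0
    rw [c k le_rfl, b k le_rfl, d k le_rfl] at e3
    have hmn := mul_pos (hm j) (hn j)
    refine ⟨?_, fun F hF hlt => ?_⟩
    · have : (-1) ^ (k + 1) * (coeffVec x m n (k + 1) 0).coeff (k + 1)
          = 2 * (m j * n j) * ((-1) ^ k * f) / E := by rw [e0]; ring
      rw [this]
      positivity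
    · have hEF : E < F := hE ▸ hlt j (Nat.lt_succ_self k)
      rw [coeff_X_mul, e3, e0]
      have : (-1) ^ (k + 1) * ((0 - (2 * m j * n j * f + 2 * (n j * 0 + m j * 0)) / E) * F
          + (0 + E * (2 * m j * n j * f + 2 * (n j * 0 + m j * 0))) / F)
          = 2 * (m j * n j) * ((-1) ^ k * f) * (F ^ 2 - E ^ 2) / (E * F) := by
        field_simp; ring
      rw [this]
      have : 0 < F ^ 2 - E ^ 2 := sub_pos.2 (pow_lt_pow_left₀ hEF hE0.le two_ne_zero)
      positivity

/-! ### Zeros and signs of real polynomials -/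

/-- A polynomial of degree at most `n`, with value `1` at `0`, that alternates in sign at
`0 = p₀ < p₁ < ⋯ < pₙ`, has simple positive zeros interlacing with these points. -/
lemma exists_interlacing_roots {P : ℝ[X]} {n : ℕ} (hdeg : P.natDegree ≤ n) {p : ℕ → ℝ}
    (hp0 : p 0 = 0) (hP : P.eval 0 = 1) (hp : ∀ i < n, p i < p (i + 1))
    (hs : ∀ i ≤ n, 0 < (-1) ^ i * P.eval (p i)) :
    ∃ r : ℕ → ℝ, (∀ i < n, p i < r i ∧ r i < p (i + 1)) ∧
      P = ∏ i ∈ Finset.range n, (1 - C (r i)⁻¹ * X) := by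
  have hroot : ∀ i, ∃ t, i < n → p i < t ∧ t < p (i + 1) ∧ P.eval t = 0 := by
    intro i
    by_cases hi : i < n
    · have h1 := hs i hi.le
      have h2 := hs (i + 1) hi
      have hc : ContinuousOn (fun t => (-1) ^ i * P.eval t) (Set.Icc (p i) (p (i + 1))) :=
        (continuous_const.mul P.continuous).continuousOn
      have h3 : (0 : ℝ) ∈ Set.Ioo ((-1) ^ i * P.eval (p (i + 1))) ((-1) ^ i * P.eval (p i)) := by
        refine ⟨?_, h1⟩
        rw [pow_succ] at h2
        linarith
      obtain ⟨t, ht, h0⟩ := intermediate_value_Ioo' (hp i hi).le hc h3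
      refine ⟨t, fun _ => ⟨ht.1, ht.2, ?_⟩⟩
      simpa using h0
    -- A default value beyond the range, so that `choose` gives a function on all of ℕ.
    · exact ⟨0, fun h => absurd h hi⟩
  choose r hr using hroot
  refine ⟨r, fun i hi => ⟨(hr i hi).1, (hr i hi).2.1⟩, ?_⟩
  have hple : ∀ i j, i ≤ j → j ≤ n → p i ≤ p j := by
    intro i j hij
    induction j, hij using Nat.le_induction with
    | base => exact fun _ => le_rfl
    | succ j _ ih => exact fun hj => (ih (by omega)).trans (hp j hj).le
  have hrpos : ∀ i < n, 0 < r i := fun i hi => by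
    have := hple 0 i (Nat.zero_le _) hi.le
    rw [hp0] at this
    exact this.trans_lt (hr i hi).1
  have hrlt : ∀ i j, i < j → j < n → r i < r j := fun i j hij hj =>
    ((hr i (by omega)).2.1.trans_le (hple (i + 1) j hij hj.le)).trans (hr j hj).1
  have hinj : Set.InjOn r (Finset.range n) := by
    intro i hi j hj hij
    rw [Finset.coe_range, Set.mem_Iio] at hi hj
    rcases lt_trichotomy i j with h | h | h
    · exact absurd hij (hrlt i j h hj).ne
    · exact h
    · exact absurd hij (hrlt j i h hi).ne'
  -- At these n + 1 points both polynomials, of degree at most n, agree: the value is 1 at 0 and 0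
  -- at each zero.
  set S : Finset ℝ := insert 0 ((Finset.range n).image r) with hS
  have hcard : S.card = n + 1 := by
    rw [hS, Finset.card_insert_of_notMem, Finset.card_image_of_injOn hinj, Finset.card_range]
    rw [Finset.mem_image]
    rintro ⟨i, hi, h0⟩
    exact (hrpos i (Finset.mem_range.1 hi)).ne' h0
  have hdegQ : (∏ i ∈ Finset.range n, (1 - C (r i)⁻¹ * X)).natDegree ≤ n := by
    refine (natDegree_prod_le _ _).trans ?_
    refine (Finset.sum_le_card_nsmul _ _ 1 fun i _ => ?_).trans (by simp)
    refine (natDegree_sub_le _ _).trans ?_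
    simpa using (natDegree_C_mul_le (r i)⁻¹ X).trans natDegree_X_le
  have hlt : ∀ Q : ℝ[X], Q.natDegree ≤ n → Q.degree < S.card := fun Q hQ => by
    rw [hcard]
    exact (degree_le_of_natDegree_le hQ).trans_lt (by exact_mod_cast Nat.lt_succ_self n)
  refine eq_of_degrees_lt_of_eval_finset_eq S (hlt _ hdeg) (hlt _ hdegQ) fun t ht => ?_
  rw [hS, Finset.mem_insert, Finset.mem_image] at ht
  rcases ht with rfl | ⟨i, hi, rfl⟩
  · rw [hP, eval_prod]; simp
  · rw [(hr i (Finset.mem_range.1 hi)).2.2, eval_prod, eq_comm]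
    refine Finset.prod_eq_zero hi ?_
    simp [(hrpos i (Finset.mem_range.1 hi)).ne']

/-- The sign of a product of linear factors over an initial segment of negative factors followed
by positive ones. -/
lemma sign_prod {ι : Type*} (s : Finset ι) (f : ι → ℝ) (q : ι → Prop) [DecidablePred q]
    (hneg : ∀ i ∈ s, q i → f i < 0) (hpos : ∀ i ∈ s, ¬ q i → 0 < f i) :
    0 < (-1) ^ (s.filter q).card * ∏ i ∈ s, f i := by
  rw [← Finset.prod_filter_mul_prod_filter_not s q f, ← mul_assoc, ← Finset.prod_const,
    ← Finset.prod_mul_distrib]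
  refine mul_pos (Finset.prod_pos fun i hi => ?_) (Finset.prod_pos fun i hi => ?_)
  · rw [Finset.mem_filter] at hi
    linarith [hneg i hi.1 hi.2]
  · rw [Finset.mem_filter] at hi
    exact hpos i hi.1 hi.2

/-- A polynomial whose coefficient number `n ≥ deg` has the sign of `(-1) ^ n` takes that sign
far to the right. -/
lemma exists_gt_sign {P : ℝ[X]} {n : ℕ} (hdeg : P.natDegree ≤ n)
    (hc : 0 < (-1) ^ n * P.coeff n) (a : ℝ) : ∃ t, a < t ∧ 0 < (-1) ^ n * P.eval t := by
  set Q : ℝ[X] := C ((-1) ^ n) * P with hQ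
  have hQc : 0 < Q.coeff n := by rwa [hQ, coeff_C_mul]
  have hQd : Q.natDegree = n :=
    le_antisymm ((natDegree_C_mul_le _ _).trans hdeg) (le_natDegree_of_ne_zero hQc.ne')
  have hev : ∀ᶠ t in atTop, 0 < Q.eval t := by
    have hlead : Q.leadingCoeff = Q.coeff n := by rw [leadingCoeff, hQd]
    -- Divergence to infinity needs positive degree; constants are treated apart.
    rcases Nat.eq_zero_or_pos n with h | h
    · obtain ⟨c, hcQ⟩ : ∃ c, Q = C c := ⟨_, eq_C_of_natDegree_eq_zero (hQd.trans h)⟩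
      refine Eventually.of_forall fun t => ?_
      subst h
      rw [hcQ] at hQc ⊢
      simpa using hQc
    · refine (Q.tendsto_atTop_of_leadingCoeff_nonneg ?_ (hlead ▸ hQc.le)).eventually_gt_atTop 0
      exact natDegree_pos_iff_degree_pos.1 (hQd ▸ h)
  obtain ⟨t, h1, h2⟩ := ((eventually_gt_atTop a).and hev).exists
  exact ⟨t, h1, by simpa [hQ] using h2⟩

/-! ### Interlacing zeros of A and alternation of B -/

/-- At a zero of the new `A`, the new `B₁` and `B₂` have the sign of the old `A`. -/
lemma sign_at_zero {A B D B' D' E f s μ ν : ℝ} (hE : 0 < E) (hs : 0 < s) (hμ : 0 < μ)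
    (hν : 0 < ν) (e0 : 0 = A - s / E * (2 * μ * ν * f + 2 * (ν * B + μ * D)))
    (e1 : B' = B + μ * f) (e2 : D' = D + ν * f) (hA : A ≠ 0)
    (hen : 0 < A * E * f + 2 * s * B * D) (hq : A * f < 0 → 0 < B * f ∧ 0 < D * f) :
    0 < A * B' ∧ 0 < A * D' := by
  have hA2 : 0 < A ^ 2 := by positivity
  -- The new A is zero, so the conserved energy is 2 s B' D'.
  have hprod : 0 < B' * D' := by
    have h1 : A * E * f + 2 * s * B * D = 2 * s * (B' * D') := by
      have h2 : A = s / E * (2 * μ * ν * f + 2 * (ν * B + μ * D)) := by linarith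
      rw [h2, e1, e2]; field_simp; ring
    exact pos_of_mul_pos_right (h1 ▸ hen) (by positivity)
  have hpp : 0 < (A * B') * (A * D') := by
    have := mul_pos hA2 hprod
    linarith
  rcases pos_and_pos_or_neg_and_neg_of_mul_pos hpp with h | ⟨hb, hd⟩
  · exact h
  -- The vanishing of the new A makes this sum a positive multiple of A². If A B' and A D' are
  -- negative, it forces A f < 0; then `hq` makes A B and A D negative as well, and the sum cannot
  -- be positive.
  have hsum : 0 < ν * (A * B) + μ * (A * D) + ν * (A * B') + μ * (A * D') := by
    have h1 : s / E * (ν * (A * B) + μ * (A * D) + ν * (A * B') + μ * (A * D')) = A ^ 2 := by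
      rw [e1, e2]; linear_combination A * e0
    exact pos_of_mul_pos_right (h1 ▸ hA2) (div_pos hs hE).le
  have h3 := mul_neg_of_pos_of_neg hν hb
  have h4 := mul_neg_of_pos_of_neg hμ hd
  have hAf : A * f < 0 := by
    have h1 : 2 * (μ * ν) * (A * f) = ν * (A * B') + μ * (A * D')
        - (ν * (A * B) + μ * (A * D)) := by rw [e1, e2]; ring
    have h2 : 2 * (μ * ν) * (A * f) < 0 := by linarith
    exact neg_of_mul_neg_right h2 (by positivity)
  obtain ⟨h1, h2⟩ := hq hAf
  have hAB : A * B < 0 := by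
    have h5 : f ^ 2 * (A * B) < 0 := by
      have := mul_neg_of_neg_of_pos hAf h1
      linarith
    exact neg_of_mul_neg_right h5 (sq_nonneg _)
  have hAD : A * D < 0 := by
    have h5 : f ^ 2 * (A * D) < 0 := by
      have := mul_neg_of_neg_of_pos hAf h2
      linarith
    exact neg_of_mul_neg_right h5 (sq_nonneg _)
  have h5 := mul_neg_of_pos_of_neg hν hAB
  have h6 := mul_neg_of_pos_of_neg hμ hAD
  linarith

lemma coeffVec_eval_zero {N : ℕ} (x m n : Fin N → ℝ) {k : ℕ} (hk : k ≤ N) :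
    (coeffVec x m n k 0).eval 0 = 1 := by
  induction k with
  | zero => simp [coeffVec]
  | succ k ih =>
    have := (coeffEval_succ x m n ⟨k, hk⟩ 0 rfl rfl).1
    simp only [coeffEval] at this
    rw [this, ih (Nat.le_of_succ_le hk)]
    simp

lemma natDegree_coeffVec_le {N : ℕ} (x m n : Fin N → ℝ) {k : ℕ} (hk : k ≤ N) :
    (coeffVec x m n k 0).natDegree ≤ k :=
  natDegree_le_iff_coeff_eq_zero.2 fun i hi => (coeffVec_coeff_eq_zero x m n hk).1 i hi

/-- The zeros of `A` are positive and simple, and `B₁` and `B₂` alternate in sign at them. -/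
theorem exists_roots {N : ℕ} {x m n : Fin N → ℝ} (hx : StrictMono x)
    (hm : ∀ j, 0 < m j) (hn : ∀ j, 0 < n j) {k : ℕ} (hk : k ≤ N) :
    ∃ r : ℕ → ℝ, (∀ i j, i < j → j < k → r i < r j) ∧ (∀ i < k, 0 < r i) ∧
      coeffVec x m n k 0 = ∏ i ∈ Finset.range k, (1 - C (r i)⁻¹ * X) ∧
      ∀ i < k, 0 < (-1) ^ i * coeffEval x m n k (r i) 1 ∧
        0 < (-1) ^ i * coeffEval x m n k (r i) 2 := by
  induction k with
  | zero => exact ⟨0, by simp, by simp, by simp [coeffVec], by simp⟩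
  | succ k ih =>
    obtain ⟨r, hlt, hpos, hA, hB⟩ := ih (Nat.le_of_succ_le hk)
    set j : Fin N := ⟨k, hk⟩ with hj
    obtain ⟨E, hE⟩ : ∃ E, E = Real.exp (x j) := ⟨_, rfl⟩
    have hE0 : 0 < E := hE ▸ Real.exp_pos _
    have hmj := hm j
    have hnj := hn j
    have step : ∀ s, _ := fun s => coeffEval_succ x m n j s hE rfl
    simp only [hj] at step
    rw [← hj] at step
    have hAev : ∀ s, coeffEval x m n k s 0 = ∏ i ∈ Finset.range k, (1 - (r i)⁻¹ * s) := fun s => by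
      simp [coeffEval, hA, eval_prod]
    have hAroot : ∀ i < k, coeffEval x m n k (r i) 0 = 0 := fun i hi => by
      rw [hAev]
      refine Finset.prod_eq_zero (Finset.mem_range.2 hi) ?_
      rw [inv_mul_cancel₀ (hpos i hi).ne', sub_self]
    -- At a zero of A the relation between r and -r retains a single term with C, whose factor A(-r)
    -- is positive.
    have hCsign : ∀ i < k, 0 ≤ (-1) ^ i * coeffEval x m n k (r i) 3 := fun i hi => by
      obtain ⟨a, b, d, -, -⟩ := coeffEval_neg_sign hx hm hn (hpos i hi) (Nat.le_of_succ_le hk)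
      have hsym := coeffEval_symmetry x m n (r i) (Nat.le_of_succ_le hk)
      rw [hAroot i hi, mul_zero, add_zero] at hsym
      obtain ⟨h1, h2⟩ := hB i hi
      have h3 := mul_nonneg h1.le d
      have h4 := mul_nonneg h2.le b
      have h5 : 0 ≤ coeffEval x m n k (-(r i)) 0 * ((-1) ^ i * coeffEval x m n k (r i) 3) := by
        have : coeffEval x m n k (-(r i)) 0 * ((-1) ^ i * coeffEval x m n k (r i) 3)
            = 2 * ((-1) ^ i * coeffEval x m n k (r i) 1 * coeffEval x m n k (-(r i)) 2)
              + 2 * ((-1) ^ i * coeffEval x m n k (r i) 2 * coeffEval x m n k (-(r i)) 1) := by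
          linear_combination (-1) ^ i * hsym
        rw [this]; positivity
      exact nonneg_of_mul_nonneg_right h5 a
    -- The sum of the zeros bounds each of them, and also gives R > 0 when there are none.
    obtain ⟨R, hR, hRs⟩ := exists_gt_sign (natDegree_coeffVec_le x m n hk)
      (sign_leading_coeff hx hm hn hk).1 (∑ i ∈ Finset.range k, r i)
    have hsum0 : 0 ≤ ∑ i ∈ Finset.range k, r i :=
      Finset.sum_nonneg fun i hi => (hpos i (Finset.mem_range.1 hi)).le
    have hrR : ∀ i < k, r i < R := fun i hi =>
      (Finset.single_le_sum (fun i hi => (hpos i (Finset.mem_range.1 hi)).le)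
        (Finset.mem_range.2 hi)).trans_lt hR
    -- The test points are 0, the old zeros shifted by one index, and R.
    let p : ℕ → ℝ := fun i => if i = 0 then 0 else if i ≤ k then r (i - 1) else R
    have hp0 : p 0 = 0 := by simp [p]
    have hpr : ∀ i < k, p (i + 1) = r i := fun i hi => by
      simp [p, Nat.succ_le_iff.2 hi]
    have hpR : p (k + 1) = R := by simp [p]
    have hpinc : ∀ i < k + 1, p i < p (i + 1) := by
      rintro (_ | i) hi
      · rw [hp0]
        rcases Nat.eq_zero_or_pos k with h | h
        · subst h; rw [hpR]; exact hsum0.trans_lt hR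
        · rw [hpr 0 h]; exact hpos 0 h
      · rw [hpr i (by omega)]
        rcases Nat.lt_or_ge (i + 1) k with h | h
        · rw [hpr _ h]; exact hlt i _ (Nat.lt_succ_self i) h
        · have : i + 1 = k := by omega
          rw [this, hpR]; exact hrR i (by omega)
    have hps : ∀ i ≤ k + 1, 0 < (-1) ^ i * (coeffVec x m n (k + 1) 0).eval (p i) := by
      rintro (_ | i) hi
      · rw [hp0, coeffVec_eval_zero x m n hk]; simp
      · rcases Nat.lt_or_ge i k with h | h
        · rw [hpr i h]
          have h1 := (step (r i)).1
          rw [hAroot i h] at h1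
          change 0 < (-1) ^ (i + 1) * coeffEval x m n (k + 1) (r i) 0
          -- Here A = 0, so f = r C / E, and every term subtracted from A has the sign (-1)^i or
          -- vanishes.
          have h2 : (-1) ^ (i + 1) * coeffEval x m n (k + 1) (r i) 0 =
              r i / E * (2 * m j * n j * (r i * ((-1) ^ i * coeffEval x m n k (r i) 3) / E)
                + 2 * (n j * ((-1) ^ i * coeffEval x m n k (r i) 1)
                  + m j * ((-1) ^ i * coeffEval x m n k (r i) 2))) := by
            rw [h1]; ring
          rw [h2]
          have h3 := hpos i h
          have h4 := hCsign i h
          obtain ⟨h5, h6⟩ := hB i h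
          positivity
        · have : i = k := by omega
          rw [this, hpR]; exact hRs
    obtain ⟨r', hr', hprod⟩ := exists_interlacing_roots (natDegree_coeffVec_le x m n hk) hp0
      (coeffVec_eval_zero x m n hk) hpinc hps
    have hple : ∀ i l, i ≤ l → l ≤ k + 1 → p i ≤ p l := by
      intro i l hil
      induction l, hil using Nat.le_induction with
      | base => exact fun _ => le_rfl
      | succ l _ ih => exact fun hl => (ih (by omega)).trans (hpinc l hl).le
    have hpos' : ∀ i < k + 1, 0 < r' i := fun i hi => by
      have := hple 0 i (Nat.zero_le _) hi.le
      rw [hp0] at this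
      exact this.trans_lt (hr' i hi).1
    refine ⟨r', fun i l hil hl => ?_, hpos', hprod, fun i hi => ?_⟩
    · exact ((hr' i (by omega)).2.trans_le (hple (i + 1) l hil hl.le)).trans (hr' l hl).1
    -- The new zero number i lies to the right of exactly i old zeros, so the old A has the sign
    -- (-1)^i there.
    · have hAs : 0 < (-1) ^ i * coeffEval x m n k (r' i) 0 := by
        have h1 := sign_prod (Finset.range k) (fun l => 1 - (r l)⁻¹ * r' i) (· < i)
          (fun l hl hli => by
            have hl := Finset.mem_range.1 hl
            have h2 := hple (l + 1) i hli hi.le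
            rw [hpr l hl] at h2
            have h3 := h2.trans_lt (hr' i hi).1
            rw [sub_neg, inv_mul_eq_div, one_lt_div (hpos l hl)]
            exact h3)
          (fun l hl hli => by
            have hl := Finset.mem_range.1 hl
            have h2 := hple (i + 1) (l + 1) (by omega) (by omega)
            rw [hpr l hl] at h2
            have h3 := (hr' i hi).2.trans_le h2
            rw [sub_pos, inv_mul_eq_div, div_lt_one (hpos l hl)]
            exact h3)
        have h2 : ((Finset.range k).filter (· < i)).card = i := by
          have : (Finset.range k).filter (· < i) = Finset.range i := by
            ext l; simp only [Finset.mem_filter, Finset.mem_range]; omega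
          rw [this, Finset.card_range]
        rwa [h2, ← hAev] at h1
      have hA0 : coeffEval x m n (k + 1) (r' i) 0 = 0 := by
        rw [coeffEval, hprod, eval_prod]
        refine Finset.prod_eq_zero (Finset.mem_range.2 hi) ?_
        simp [(hpos' i hi).ne']
      obtain ⟨e0, e1, e2, -⟩ := step (r' i)
      rw [hA0] at e0
      obtain ⟨q1, q2⟩ := energy_pos_and_sign hx hm hn (hpos' i hi) (Nat.le_of_succ_le hk) E _ hE0
        (fun l hl => hE ▸ (Real.exp_le_exp.2 (hx.monotone (show l ≤ j from hl.le)))) rfl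
      obtain ⟨s1, s2⟩ := sign_at_zero hE0 (hpos' i hi) hmj hnj e0 e1 e2
        (fun h => by rw [h, mul_zero] at hAs; exact lt_irrefl _ hAs) q1 q2
      have key : ∀ a b : ℝ, 0 < (-1) ^ i * a → 0 < a * b → 0 < (-1) ^ i * b := by
        intro a b ha hab
        have h1 : 0 < a ^ 2 * ((-1) ^ i * b) := by
          have := mul_pos ha hab
          linarith
        exact pos_of_mul_pos_right h1 (sq_nonneg _)
      exact ⟨key _ _ hAs s1, key _ _ hAs s2⟩

/-! ### Partial fractions, residues and discrete measures -/

/-- The coefficient of `1 / (X - λ_k)` in the partial fraction decomposition of `-B / A`, where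
`A = ∏ (1 - X / λ_j)`. -/
noncomputable def fracCoeff {N : ℕ} (lam : Fin N → ℝ) (B : ℝ[X]) (k : Fin N) : ℝ :=
  lam k * B.eval (lam k) / ∏ j ∈ Finset.univ.erase k, (1 - (lam j)⁻¹ * lam k)

lemma prod_erase_ne_zero {N : ℕ} {lam : Fin N → ℝ} (hinj : Function.Injective lam)
    (h0 : ∀ k, lam k ≠ 0) (k : Fin N) :
    ∏ j ∈ Finset.univ.erase k, (1 - (lam j)⁻¹ * lam k) ≠ 0 := by
  refine Finset.prod_ne_zero_iff.2 fun j hj => ?_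
  rw [sub_ne_zero]
  intro h
  rw [eq_inv_mul_iff_mul_eq₀ (h0 j), mul_one] at h
  exact (Finset.ne_of_mem_erase hj) (hinj h)

/-- The partial fraction decomposition of `-B / A`. -/
lemma partial_fractions {N : ℕ} {lam : Fin N → ℝ} (hinj : Function.Injective lam)
    (h0 : ∀ k, lam k ≠ 0) {A B : ℝ[X]} (hA : A = ∏ k, (1 - C (lam k)⁻¹ * X))
    (hB : ∀ i, N ≤ i → B.coeff i = 0) {K : Type*} [Field K] [Algebra ℝ K] (w : K)
    (hw : ∀ k, w ≠ algebraMap ℝ K (lam k)) :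
    -(aeval w B / aeval w A) =
      ∑ k, algebraMap ℝ K (fracCoeff lam B k) / (w - algebraMap ℝ K (lam k)) := by
  -- The field is ℂ for the Weyl functions and ℝ for the values at -λ_k. The `Q k / a k` are the
  -- Lagrange basis polynomials at the zeros of A, and B, of degree below N, is its own interpolant.
  set a : Fin N → ℝ := fun k => ∏ j ∈ Finset.univ.erase k, (1 - (lam j)⁻¹ * lam k) with ha
  set Q : Fin N → ℝ[X] := fun k => ∏ j ∈ Finset.univ.erase k, (1 - C (lam j)⁻¹ * X) with hQ
  have ha0 : ∀ k, a k ≠ 0 := prod_erase_ne_zero hinj h0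
  have hQdeg : ∀ k, (Q k).degree < N := fun k => by
    have h1 : (Q k).natDegree ≤ N - 1 := by
      refine (natDegree_prod_le _ _).trans ?_
      refine (Finset.sum_le_card_nsmul _ _ 1 fun i _ => ?_).trans
        (by simp [Finset.card_erase_of_mem])
      refine (natDegree_sub_le _ _).trans ?_
      simpa using (natDegree_C_mul_le (lam i)⁻¹ X).trans natDegree_X_le
    refine (degree_le_of_natDegree_le h1).trans_lt ?_
    have := k.pos
    exact_mod_cast (by omega : N - 1 < N)
  have hQeval : ∀ k l, (Q k).eval (lam l) = if l = k then a k else 0 := fun k l => by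
    split_ifs with h
    · subst h; simp [hQ, ha, eval_prod]
    · rw [hQ, eval_prod]
      refine Finset.prod_eq_zero (Finset.mem_erase.2 ⟨h, Finset.mem_univ l⟩) ?_
      simp [h0 l]
  have hid : B = ∑ k, C (B.eval (lam k) / a k) * Q k := by
    have hcard : (Finset.univ.image lam).card = N := by
      rw [Finset.card_image_of_injective _ hinj, Finset.card_fin]
    refine eq_of_degrees_lt_of_eval_finset_eq (Finset.univ.image lam) ?_ ?_ ?_
    · rw [hcard]
      exact (degree_lt_iff_coeff_zero B N).2 hB
    · rw [hcard]
      refine (degree_sum_le _ _).trans_lt ?_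
      refine (Finset.sup_lt_iff (WithBot.bot_lt_coe N)).2 fun k _ => ?_
      rw [← smul_eq_C_mul]
      exact (degree_smul_le _ _).trans_lt (hQdeg k)
    · intro t ht
      obtain ⟨l, -, rfl⟩ := Finset.mem_image.1 ht
      simp [eval_finsetSum, hQeval, div_mul_cancel₀ _ (ha0 l)]
  have hAQ : ∀ k, aeval w A = (1 - algebraMap ℝ K (lam k)⁻¹ * w) * aeval w (Q k) := fun k => by
    rw [hA, ← Finset.mul_prod_erase Finset.univ _ (Finset.mem_univ k)]
    simp [hQ]
  have hlam : ∀ k, algebraMap ℝ K (lam k) ≠ 0 := fun k => by simpa using h0 k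
  have hA0 : aeval w A ≠ 0 := by
    rw [hA, map_prod]
    refine Finset.prod_ne_zero_iff.2 fun k _ => ?_
    simp only [map_sub, map_one, map_mul, aeval_C, aeval_X, map_inv₀]
    rw [sub_ne_zero]
    intro h
    rw [eq_inv_mul_iff_mul_eq₀ (hlam k), mul_one] at h
    exact hw k h.symm
  conv_lhs => rw [hid, map_sum]
  rw [Finset.sum_div, ← Finset.sum_neg_distrib]
  refine Finset.sum_congr rfl fun k _ => ?_
  have hQ0 : aeval w (Q k) ≠ 0 := fun h => hA0 (by rw [hAQ k, h, mul_zero])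
  have hwk : w - algebraMap ℝ K (lam k) ≠ 0 := sub_ne_zero.2 (hw k)
  have hak : algebraMap ℝ K (a k) ≠ 0 := by simpa using ha0 k
  have hfac : 1 - (algebraMap ℝ K (lam k))⁻¹ * w
      = -(w - algebraMap ℝ K (lam k)) / algebraMap ℝ K (lam k) := by
    field_simp [hlam k]; ring
  have hfr : algebraMap ℝ K (fracCoeff lam B k) =
      algebraMap ℝ K (lam k) * (algebraMap ℝ K (B.eval (lam k)) / algebraMap ℝ K (a k)) := by
    rw [fracCoeff, mul_div_assoc, map_mul, map_div₀]
  rw [hAQ k, map_mul, aeval_C, map_div₀, hfr, map_inv₀, hfac]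
  have := hlam k
  field_simp

/-- Since the points are distinct, the terms other than the k-th are analytic at λ_k. -/
lemma hasSimpleResidue_of_partial_fractions {N : ℕ} {lam : Fin N → ℝ}
    (hinj : Function.Injective lam) {f : ℂ → ℂ} {b : Fin N → ℝ}
    (hf : ∀ w : ℂ, (∀ k, w ≠ (lam k : ℂ)) → f w = ∑ k, (b k : ℂ) / (w - (lam k : ℂ)))
    (k : Fin N) : HasSimpleResidue f (lam k) (b k) := by
  have hne : ∀ j ∈ Finset.univ.erase k, (lam k : ℂ) ≠ (lam j : ℂ) := fun j hj h =>
    (Finset.ne_of_mem_erase hj) (hinj (Complex.ofReal_injective h)).symm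
  refine ⟨fun w => ∑ j ∈ Finset.univ.erase k, (b j : ℂ) / (w - (lam j : ℂ)), ?_, ?_⟩
  · refine Finset.analyticAt_fun_sum _ fun j hj => ?_
    exact analyticAt_const.fun_div (analyticAt_id.fun_sub analyticAt_const)
      (sub_ne_zero.2 (hne j hj))
  · have h1 : ∀ᶠ w in 𝓝[≠] (lam k : ℂ), ∀ j, w ≠ (lam j : ℂ) := by
      refine eventually_all.2 fun j => ?_
      by_cases hj : j = k
      · subst hj; exact self_mem_nhdsWithin
      · exact eventually_nhdsWithin_of_eventually_nhds
          (eventually_ne_nhds (hne j (Finset.mem_erase.2 ⟨hj, Finset.mem_univ j⟩)))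
    filter_upwards [h1] with w hw
    rw [hf w hw, Finset.add_sum_erase _ (fun j => (b j : ℂ) / (w - (lam j : ℂ)))
      (Finset.mem_univ k)]

lemma integral_spectralMeasure {N : ℕ} (lam : Fin N → ℝ) {b : Fin N → Fin 2 → ℝ}
    (hb : ∀ k a, 0 < b k a) (a : Fin 2) (f : ℝ → ℂ) :
    ∫ s, f s ∂(spectralMeasure lam b a) = ∑ k, (b k a : ℂ) * f (lam k) := by
  rw [spectralMeasure, integral_finsetSum_measure]
  · refine Finset.sum_congr rfl fun k _ => ?_
    rw [integral_smul_measure, integral_dirac, ENNReal.toReal_ofReal (hb k a).le,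
      Complex.real_smul]
  · intro k _
    exact (integrable_dirac (by simp)).smul_measure ENNReal.ofReal_ne_top

/-- The pole in w depends on s only, so the integration in t collects the coefficient at λ_k; the
two iterated integrals supply the two products of ⟨b_k, b_p⟩. -/
lemma pairingIntegral_spectralMeasure {N : ℕ} (lam : Fin N → ℝ) {b : Fin N → Fin 2 → ℝ}
    (hb : ∀ k a, 0 < b k a) (w : ℂ) :
    pairingIntegral (spectralMeasure lam b)
        (fun s t => 1 / ((w - (s : ℂ)) * ((s : ℂ) + (t : ℂ)))) =
      ∑ k, ((∑ p, pairing (b k) (b p) / (lam k + lam p) : ℝ) : ℂ) / (w - (lam k : ℂ)) := by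
  simp only [pairingIntegral, integral_spectralMeasure lam hb]
  rw [← Finset.sum_add_distrib]
  refine Finset.sum_congr rfl fun k _ => ?_
  rw [Finset.mul_sum, Finset.mul_sum, ← Finset.sum_add_distrib, Complex.ofReal_sum,
    Finset.sum_div]
  refine Finset.sum_congr rfl fun p _ => ?_
  simp only [pairing]
  push_cast
  rw [one_div, mul_inv]
  ring

/-! ### Positivity of the residues and the formula for c_k -/

/-- If `B` alternates in sign at the zeros of `A`, the partial fraction coefficients are positive. -/
lemma fracCoeff_pos {N : ℕ} {lam : Fin N → ℝ} (hanti : StrictAnti lam) (hpos : ∀ k, 0 < lam k)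
    {B : ℝ[X]} (k : Fin N) (hB : 0 < (-1) ^ k.rev.val * B.eval (lam k)) :
    0 < fracCoeff lam B k := by
  have h1 := sign_prod (Finset.univ.erase k) (fun j => 1 - (lam j)⁻¹ * lam k) (k < ·)
    (fun j _ hj => by
      rw [sub_neg, inv_mul_eq_div, one_lt_div (hpos j)]
      exact hanti hj)
    (fun j hj hjk => by
      rw [sub_pos, inv_mul_eq_div, div_lt_one (hpos j)]
      exact hanti (lt_of_le_of_ne (not_lt.1 hjk) (Finset.ne_of_mem_erase hj)))
  -- The negative factors belong to the λ_j below λ_k, that is to j > k; their number is the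
  -- position of λ_k in increasing order.
  have h2 : ((Finset.univ.erase k).filter (k < ·)).card = k.rev.val := by
    have : (Finset.univ.erase k).filter (k < ·) = Finset.Ioi k := by
      ext j
      simp only [Finset.mem_filter, Finset.mem_erase, Finset.mem_univ, and_true, Finset.mem_Ioi]
      exact ⟨fun h => h.2, fun h => ⟨h.ne', h⟩⟩
    rw [this, Fin.card_Ioi, Fin.val_rev]
    omega
  rw [h2] at h1
  have h3 : fracCoeff lam B k = lam k * ((-1) ^ k.rev.val * B.eval (lam k)) /
      ((-1) ^ k.rev.val * ∏ j ∈ Finset.univ.erase k, (1 - (lam j)⁻¹ * lam k)) := by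
    rw [fracCoeff, mul_left_comm, mul_div_mul_left _ _ (pow_ne_zero _ (by norm_num))]
  rw [h3]
  exact div_pos (mul_pos (hpos k) hB) h1

/-- The coefficients of `Z` in terms of those of `W`. -/
lemma fracCoeff_eq_sum_pairing {N : ℕ} (x m n : Fin N → ℝ) {lam : Fin N → ℝ}
    (hinj : Function.Injective lam) (hpos : ∀ k, 0 < lam k)
    (hA : polyA x m n = ∏ k, (1 - C (lam k)⁻¹ * X)) (k : Fin N) :
    fracCoeff lam (C (1 / 2) * polyC x m n) k =
      ∑ p, pairing (fun a => fracCoeff lam (polyB x m n a) k)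
        (fun a => fracCoeff lam (polyB x m n a) p) / (lam k + lam p) := by
  obtain ⟨-, hc1, hc2, -⟩ := coeffVec_coeff_eq_zero x m n le_rfl
  have hcB : ∀ a i, N ≤ i → (polyB x m n a).coeff i = 0 := by
    intro a; fin_cases a
    · exact hc1
    · exact hc2
  have hne : ∀ p, -lam k ≠ algebraMap ℝ ℝ (lam p) := fun p => by
    have h1 := hpos k
    have h2 := hpos p
    rw [Algebra.algebraMap_self_apply]
    exact (by linarith : -lam k < lam p).ne
  -- This is -W(-λ_k); its denominators are λ_k + λ_p because -λ_k - λ_p changes sign.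
  have hW : ∀ a, (polyB x m n a).eval (-lam k) / (polyA x m n).eval (-lam k) =
      ∑ p, fracCoeff lam (polyB x m n a) p / (lam k + lam p) := fun a => by
    have h1 := partial_fractions hinj (fun p => (hpos p).ne') hA (hcB a) (-lam k) hne
    simp only [Algebra.algebraMap_self_apply, coe_aeval_eq_eval] at h1
    rw [neg_eq_iff_eq_neg] at h1
    rw [h1, ← Finset.sum_neg_distrib]
    refine Finset.sum_congr rfl fun p _ => ?_
    rw [← div_neg]
    congr 1
    ring
  have hA1 : (polyA x m n).eval (lam k) = 0 := by
    rw [hA, eval_prod]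
    exact Finset.prod_eq_zero (Finset.mem_univ k) (by simp [(hpos k).ne'])
  have hA2 : (polyA x m n).eval (-lam k) ≠ 0 := by
    rw [hA, eval_prod]
    refine Finset.prod_ne_zero_iff.2 fun p _ => ?_
    have h1 : 0 < (lam p)⁻¹ * lam k := mul_pos (inv_pos.2 (hpos p)) (hpos k)
    simp only [eval_sub, eval_one, eval_mul, eval_C, eval_X]
    linarith
  have hsym : (polyC x m n).eval (lam k) * (polyA x m n).eval (-lam k)
      + (polyC x m n).eval (-lam k) * (polyA x m n).eval (lam k) =
      2 * ((polyB x m n 0).eval (lam k) * (polyB x m n 1).eval (-lam k)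
        + (polyB x m n 1).eval (lam k) * (polyB x m n 0).eval (-lam k)) :=
    coeffEval_symmetry x m n (lam k) le_rfl
  rw [hA1, mul_zero, add_zero] at hsym
  -- With A(λ_k) = 0 the bilinear relation gives C(λ_k) through B(λ_k) and the quotients B/A at
  -- -λ_k.
  have hCk : (polyC x m n).eval (lam k) = 2 * ((polyB x m n 0).eval (lam k) *
      ((polyB x m n 1).eval (-lam k) / (polyA x m n).eval (-lam k))
      + (polyB x m n 1).eval (lam k) *
      ((polyB x m n 0).eval (-lam k) / (polyA x m n).eval (-lam k))) := by
    field_simp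
    linear_combination hsym
  have hsplit : ∀ p, pairing (fun a => fracCoeff lam (polyB x m n a) k)
        (fun a => fracCoeff lam (polyB x m n a) p) / (lam k + lam p) =
      fracCoeff lam (polyB x m n 0) k * (fracCoeff lam (polyB x m n 1) p / (lam k + lam p)) +
      fracCoeff lam (polyB x m n 1) k * (fracCoeff lam (polyB x m n 0) p / (lam k + lam p)) :=
    fun p => by rw [pairing]; ring
  rw [Finset.sum_congr rfl fun p _ => hsplit p, Finset.sum_add_distrib, ← Finset.mul_sum,
    ← Finset.mul_sum, ← hW 0, ← hW 1]
  rw [fracCoeff, fracCoeff, fracCoeff, eval_mul, eval_C, hCk]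
  ring

end NovikovPeakon

/-! ### Assembly -/

theorem mainTheorem7 (N : ℕ) (x m n : Fin N → ℝ) (hx : StrictMono x)
    (hm : ∀ j, 0 < m j) (hn : ∀ j, 0 < n j) :
    ∃ lam : Fin N → ℝ,
      -- the spectrum: `z` is an eigenvalue iff `-z ^ 2` is one of `λ₁ > ⋯ > λ_N > 0`
      StrictAnti lam ∧ (∀ k, 0 < lam k) ∧
      (∀ z : ℂ, NovikovPeakon.IsLaxEigenvalue x m n z ↔ ∃ k, -z ^ 2 = (lam k : ℂ)) ∧
      NovikovPeakon.polyA x m n = ∏ k, (1 - Polynomial.C (lam k)⁻¹ * Polynomial.X) ∧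
      ∃ (b : Fin N → Fin 2 → ℝ) (c : Fin N → ℝ),
        -- the residues and their positivity
        (∀ k a, NovikovPeakon.HasSimpleResidue
          (fun w => NovikovPeakon.weylW x m n w a) (lam k) (b k a)) ∧
        (∀ k, NovikovPeakon.HasSimpleResidue
          (NovikovPeakon.weylZ x m n) (lam k) (c k)) ∧
        (∀ k a, 0 < b k a) ∧ (∀ k, 0 < c k) ∧
        (∀ k, c k = ∑ p, NovikovPeakon.pairing (b k) (b p) / (lam k + lam p)) ∧
        -- the partial fractions and the Stieltjes representations
        (∀ w : ℂ, (∀ k, w ≠ (lam k : ℂ)) →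
          (∀ a, NovikovPeakon.weylW x m n w a = ∑ k, (b k a : ℂ) / (w - (lam k : ℂ)) ∧
            NovikovPeakon.weylW x m n w a =
              ∫ s, 1 / (w - (s : ℂ)) ∂(NovikovPeakon.spectralMeasure lam b a)) ∧
          NovikovPeakon.weylZ x m n w = ∑ k, (c k : ℂ) / (w - (lam k : ℂ)) ∧
          NovikovPeakon.weylZ x m n w =
            NovikovPeakon.pairingIntegral (NovikovPeakon.spectralMeasure lam b)
              (fun s t => 1 / ((w - (s : ℂ)) * ((s : ℂ) + (t : ℂ))))) := by
  obtain ⟨r, hlt, hpos, hA, hB⟩ := NovikovPeakon.exists_roots hx hm hn (le_refl N)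
  obtain ⟨-, hc1, hc2, hc3⟩ := NovikovPeakon.coeffVec_coeff_eq_zero x m n (le_refl N)
  -- The zeros were found in increasing order, whereas the λ_k decrease.
  set lam : Fin N → ℝ := fun k => r k.rev with hlam
  have hanti : StrictAnti lam := fun i j hij => hlt _ _ (Fin.rev_lt_rev.2 hij) i.rev.2
  have hlpos : ∀ k, 0 < lam k := fun k => hpos _ k.rev.2
  have hinj := hanti.injective
  have hA' : NovikovPeakon.polyA x m n =
      ∏ k, (1 - Polynomial.C (lam k)⁻¹ * Polynomial.X) := by
    rw [NovikovPeakon.polyA, hA, ← Fin.prod_univ_eq_prod_range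
      (fun i => 1 - Polynomial.C (r i)⁻¹ * Polynomial.X) N]
    exact (Equiv.prod_comp Fin.revPerm
      (fun k : Fin N => 1 - Polynomial.C (r k)⁻¹ * Polynomial.X)).symm
  have hcB : ∀ a i, N ≤ i → (NovikovPeakon.polyB x m n a).coeff i = 0 := by
    intro a; fin_cases a
    · exact hc1
    · exact hc2
  -- The factor 1/2 turns Z = -C/(2A) into -(C/2)/A, the form required for partial fractions.
  have hcC : ∀ i, N ≤ i →
      (Polynomial.C (1 / 2) * NovikovPeakon.polyC x m n).coeff i = 0 := fun i hi => by
    rw [Polynomial.coeff_C_mul, NovikovPeakon.polyC, hc3 i hi, mul_zero]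
  set b : Fin N → Fin 2 → ℝ :=
    fun k a => NovikovPeakon.fracCoeff lam (NovikovPeakon.polyB x m n a) k with hb
  set c : Fin N → ℝ := fun k => NovikovPeakon.fracCoeff lam
    (Polynomial.C (1 / 2) * NovikovPeakon.polyC x m n) k with hc
  have hbpos : ∀ k a, 0 < b k a := by
    intro k a
    refine NovikovPeakon.fracCoeff_pos hanti hlpos k ?_
    fin_cases a
    · exact (hB _ k.rev.2).1
    · exact (hB _ k.rev.2).2
  have hcsum : ∀ k, c k = ∑ p, NovikovPeakon.pairing (b k) (b p) / (lam k + lam p) :=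
    NovikovPeakon.fracCoeff_eq_sum_pairing x m n hinj hlpos hA'
  have hW : ∀ a, ∀ w : ℂ, (∀ k, w ≠ (lam k : ℂ)) →
      NovikovPeakon.weylW x m n w a = ∑ k, (b k a : ℂ) / (w - (lam k : ℂ)) := fun a w hw =>
    NovikovPeakon.partial_fractions hinj (fun k => (hlpos k).ne') hA' (hcB a) w hw
  have hZ : ∀ w : ℂ, (∀ k, w ≠ (lam k : ℂ)) →
      NovikovPeakon.weylZ x m n w = ∑ k, (c k : ℂ) / (w - (lam k : ℂ)) := fun w hw => by
    refine Eq.trans ?_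
      (NovikovPeakon.partial_fractions hinj (fun k => (hlpos k).ne') hA' hcC w hw)
    rw [NovikovPeakon.weylZ, map_mul, Polynomial.aeval_C]
    simp only [one_div, map_inv₀, map_ofNat]
    rw [← div_div]
    ring
  refine ⟨lam, hanti, hlpos, fun z => ?_, hA', b, c,
    fun k a => NovikovPeakon.hasSimpleResidue_of_partial_fractions hinj (hW a) k,
    fun k => NovikovPeakon.hasSimpleResidue_of_partial_fractions hinj hZ k, hbpos, fun k => ?_,
    hcsum, fun w hw => ⟨fun a => ⟨hW a w hw, ?_⟩, hZ w hw, ?_⟩⟩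
  · rw [NovikovPeakon.isLaxEigenvalue_iff m n hx z, hA', map_prod, Finset.prod_eq_zero_iff]
    simp only [Finset.mem_univ, true_and]
    refine exists_congr fun k => ?_
    have hk : (lam k : ℂ) ≠ 0 := Complex.ofReal_ne_zero.2 (hlpos k).ne'
    simp only [map_sub, map_one, map_mul, Polynomial.aeval_C, Polynomial.aeval_X, map_inv₀,
      Complex.coe_algebraMap]
    rw [sub_eq_zero, eq_inv_mul_iff_mul_eq₀ hk, mul_one, eq_comm]
  · rw [hcsum k]
    refine Finset.sum_pos (fun p _ => ?_) ⟨k, Finset.mem_univ k⟩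
    refine div_pos ?_ (add_pos (hlpos k) (hlpos p))
    exact add_pos (mul_pos (hbpos k 0) (hbpos p 1)) (mul_pos (hbpos k 1) (hbpos p 0))
  · rw [hW a w hw, NovikovPeakon.integral_spectralMeasure lam hbpos]
    exact Finset.sum_congr rfl fun k _ => by rw [mul_one_div]
  · rw [hZ w hw, NovikovPeakon.pairingIntegral_spectralMeasure lam hbpos]
    exact Finset.sum_congr rfl fun k _ => by rw [← hcsum k]
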